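/- An $[[n,k,d]]$ stabilizer code is given by an abelian subgroup $\mathcal S$ of the $n$-qubit Pauli group with $-I\notin\mathcal S$; its code space $\{\psi : S\psi=\psi\ \forall S\in\mathcal S\}$ has dimension $2^k$, and $d$ is the minimum weight of a Pauli error that maps a codeword to another codeword (a vector of the code space that is not a scalar multiple of the first; such errors exist exactly when $k\ge 1$). Fix constants $A,r>0$ and $w,b\in\mathbb N$. A stabilizer code on $n$ qubits is *implemented as a qLDPC code in the stacked architecture* (with these constants) if its qubits are placed at points of $\mathbb R^2$ with pairwise distance at least $1$ inside a square of side length $A\sqrt n$ (e.g. a $\sqrt n\times\sqrt n$ lattice), and $\mathcal S$ is given with a finite list of generators, each acting on at most $w$ qubits, which are distributed over layers $i\ge 0$ with $2^i\le A\sqrt n$ such that each generator of layer $i$ acts inside a ball of radius $r2^i$ and, for every $i$, each point of the plane lies in at most $b$ of the balls of layer $i$ (one ball for each generator; that is, the balls of one layer partition the plane up to bounded overlap). An *interaction* is an unordered pair of distinct qubits that both lie in the support of some generator of the list; its length is the distance between the two qubits. **Corollary.** There is a constant $C>0$, depending only on $A,r,w,b$, such that: 1. for every $n$, every code on $n$ qubits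 with a stacked implementation with these constants, and every real $\ell>0$, there are at most $C\,n/\ell^2$ interactions of length at least $\ell$; 2. every $[[n,k,d]]$ stabilizer code that has a stacked implementation with these constants satisfies $d\le C\,n^{2/3}$ and $k d^2\cdot\max(k,d)^2\le C\,n^3$. In particular, codes with the parameters $k=\Theta(n)$, $d=\Theta(n^{1/2})$ of hypergraph product codes, and codes with the parameters $k=\tilde\Theta(n^{4/5})$, $d=\tilde\Theta(n^{3/5})$ of balanced product codes, cannot be implemented in this architecture: 3. for every $a>0$ there is an $N$ (depending only on $a,A,r,w,b$) such that no $[[n,k,d]]$ stabilizer code with $n\ge N$, $k\ge a n$ and $d\ge a\sqrt n$ has a stacked implementation with these constants; 4. for every $a>0$ and $s\in\mathbb N$ there is an $N$ (depending only on $a,s,A,r,w,b$) such that no $[[n,k,d]]$ stabilizer code with $n\ge N$, $k\ge a n^{4/5}/(\log n)^s$ and $d\ge a n^{3/5}/(\log n)^s$ has a stacked implementation with these constants. -/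

import Mathlib

open scoped Matrix

/-- The labels of the four single-qubit Pauli operators. -/
inductive Pauli
  | I
  | X
  | Y
  | Z

/-- The single-qubit Pauli matrices. -/
noncomputable def Pauli.mat : Pauli → Matrix (Fin 2) (Fin 2) ℂ
  | .I => !![1, 0; 0, 1]
  | .X => !![0, 1; 1, 0]
  | .Y => !![0, -Complex.I; Complex.I, 0]
  | .Z => !![1, 0; 0, -1]

/-- Operators on `n` qubits: matrices in the computational basis, which consists of the
bit strings of length `n`. -/
abbrev QubitOp (n : ℕ) : Type := Matrix (Fin n → Fin 2) (Fin n → Fin 2) ℂ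

/-- The tensor product `P 0 ⊗ P 1 ⊗ ⋯ ⊗ P (n-1)` of single-qubit Pauli operators. -/
noncomputable def pauliString {n : ℕ} (P : Fin n → Pauli) : QubitOp n :=
  Matrix.of fun x y => ∏ q, (P q).mat (x q) (y q)

theorem Pauli.mat_mul_self (P : Pauli) : P.mat * P.mat = 1 := by
  cases P <;> ext i j <;> fin_cases i <;> fin_cases j <;> simp [Pauli.mat]

theorem Pauli.exists_mat_mul (P Q : Pauli) :
    ∃ (t : ℕ) (R : Pauli), P.mat * Q.mat = Complex.I ^ t • R.mat := by
  cases P <;> cases Q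
  · exact ⟨0, .I, by ext i j; fin_cases i <;> fin_cases j <;> simp [Pauli.mat]⟩
  · exact ⟨0, .X, by ext i j; fin_cases i <;> fin_cases j <;> simp [Pauli.mat]⟩
  · exact ⟨0, .Y, by ext i j; fin_cases i <;> fin_cases j <;> simp [Pauli.mat]⟩
  · exact ⟨0, .Z, by ext i j; fin_cases i <;> fin_cases j <;> simp [Pauli.mat]⟩
  · exact ⟨0, .X, by ext i j; fin_cases i <;> fin_cases j <;> simp [Pauli.mat]⟩
  · exact ⟨0, .I, by ext i j; fin_cases i <;> fin_cases j <;> simp [Pauli.mat]⟩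
  · exact ⟨1, .Z, by ext i j; fin_cases i <;> fin_cases j <;> simp [Pauli.mat]⟩
  · exact ⟨3, .Y, by ext i j; fin_cases i <;> fin_cases j <;> simp [Pauli.mat, pow_succ]⟩
  · exact ⟨0, .Y, by ext i j; fin_cases i <;> fin_cases j <;> simp [Pauli.mat]⟩
  · exact ⟨3, .Z, by ext i j; fin_cases i <;> fin_cases j <;> simp [Pauli.mat, pow_succ]⟩
  · exact ⟨0, .I, by ext i j; fin_cases i <;> fin_cases j <;> simp [Pauli.mat]⟩
  · exact ⟨1, .X, by ext i j; fin_cases i <;> fin_cases j <;> simp [Pauli.mat]⟩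
  · exact ⟨0, .Z, by ext i j; fin_cases i <;> fin_cases j <;> simp [Pauli.mat]⟩
  · exact ⟨1, .Y, by ext i j; fin_cases i <;> fin_cases j <;> simp [Pauli.mat]⟩
  · exact ⟨3, .X, by ext i j; fin_cases i <;> fin_cases j <;> simp [Pauli.mat, pow_succ]⟩
  · exact ⟨0, .I, by ext i j; fin_cases i <;> fin_cases j <;> simp [Pauli.mat]⟩

theorem pauliString_mul_apply {n : ℕ} (P Q : Fin n → Pauli) (x y : Fin n → Fin 2) :
    (pauliString P * pauliString Q) x y = ∏ q, ((P q).mat * (Q q).mat) (x q) (y q) := by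
  simp only [pauliString, Matrix.mul_apply, Matrix.of_apply, ← Finset.prod_mul_distrib]
  rw [Finset.prod_univ_sum, Fintype.piFinset_univ]

theorem pauliString_one {n : ℕ} : pauliString (fun _ : Fin n => Pauli.I) = 1 := by
  ext x y
  have h : Pauli.mat .I = 1 := by
    ext i j; fin_cases i <;> fin_cases j <;> simp [Pauli.mat]
  simp only [pauliString, Matrix.of_apply, h, Matrix.one_apply]
  by_cases hxy : x = y
  · simp [hxy]
  · obtain ⟨q, hq⟩ := Function.ne_iff.mp hxy
    rw [if_neg hxy]
    exact Finset.prod_eq_zero (Finset.mem_univ q) (by simp [hq])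

theorem pauliString_mul_self {n : ℕ} (P : Fin n → Pauli) :
    pauliString P * pauliString P = 1 := by
  ext x y
  rw [pauliString_mul_apply, ← pauliString_one]
  have h : Pauli.mat .I = 1 := by
    ext i j; fin_cases i <;> fin_cases j <;> simp [Pauli.mat]
  simp [pauliString, Pauli.mat_mul_self, h]

theorem exists_pauliString_mul {n : ℕ} (P Q : Fin n → Pauli) :
    ∃ (t : ℕ) (R : Fin n → Pauli),
      pauliString P * pauliString Q = Complex.I ^ t • pauliString R := by
  choose t R h using fun q => Pauli.exists_mat_mul (P q) (Q q)
  refine ⟨∑ q, t q, R, ?_⟩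
  ext x y
  rw [pauliString_mul_apply]
  simp [h, pauliString, Finset.prod_mul_distrib, Finset.prod_pow_eq_pow_sum]

/-- The `n`-qubit Pauli group: tensor products of single-qubit Pauli operators, times one of
the scalars `1, i, -1, -i`. -/
noncomputable def pauliGroup (n : ℕ) : Subgroup (QubitOp n)ˣ where
  carrier := {U | ∃ (t : ℕ) (P : Fin n → Pauli), (U : QubitOp n) = Complex.I ^ t • pauliString P}
  one_mem' := ⟨0, fun _ => .I, by simp [pauliString_one]⟩
  mul_mem' := by
    rintro U V ⟨s, P, hP⟩ ⟨t, Q, hQ⟩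
    obtain ⟨u, R, hR⟩ := exists_pauliString_mul P Q
    refine ⟨s + t + u, R, ?_⟩
    rw [Units.val_mul, hP, hQ, smul_mul_smul_comm, hR, smul_smul, pow_add, pow_add]
  inv_mem' := by
    rintro U ⟨t, P, hP⟩
    refine ⟨3 * t, P, ?_⟩
    rw [Units.inv_eq_of_mul_eq_one_right]
    rw [hP, smul_mul_smul_comm, pauliString_mul_self, ← pow_add,
      show t + 3 * t = 4 * t by ring, pow_mul, Complex.I_pow_four, one_pow, one_smul]

/-- The support of a Pauli operator: the qubits on which it does not act as the identity. -/
def pauliSupport {n : ℕ} (U : (QubitOp n)ˣ) : Set (Fin n) :=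
  {q | ∃ (t : ℕ) (P : Fin n → Pauli),
    (U : QubitOp n) = Complex.I ^ t • pauliString P ∧ P q ≠ Pauli.I}

/-- The weight of a Pauli operator: the number of qubits in its support. -/
noncomputable def pauliWeight {n : ℕ} (U : (QubitOp n)ˣ) : ℕ := (pauliSupport U).ncard

/-- A stabilizer code on `n` qubits, given by its stabilizer group: an abelian subgroup of the
`n`-qubit Pauli group that does not contain `-1`. -/
structure StabilizerCode (n : ℕ) where
  stabilizer : Subgroup (QubitOp n)ˣ
  le_pauliGroup : stabilizer ≤ pauliGroup n
  comm : ∀ g ∈ stabilizer, ∀ h ∈ stabilizer, g * h = h * g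
  neg_one_notMem : -1 ∉ stabilizer

namespace StabilizerCode

variable {n : ℕ}

/-- The space of code states: the vectors fixed by every stabilizer. -/
def codeSpace (𝒞 : StabilizerCode n) : Submodule ℂ ((Fin n → Fin 2) → ℂ) where
  carrier := {ψ | ∀ g ∈ 𝒞.stabilizer, (g : QubitOp n) *ᵥ ψ = ψ}
  zero_mem' := fun g _ => Matrix.mulVec_zero _
  add_mem' := fun ha hb g hg => by rw [Matrix.mulVec_add, ha g hg, hb g hg]
  smul_mem' := fun c ψ hψ g hg => by rw [Matrix.mulVec_smul, hψ g hg]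

/-- A Pauli error that maps some codeword to another codeword. Codewords are states, so two
vectors that differ by a scalar factor are not different codewords. -/
def IsLogicalError (𝒞 : StabilizerCode n) (E : (QubitOp n)ˣ) : Prop :=
  E ∈ pauliGroup n ∧ ∃ ψ ∈ 𝒞.codeSpace,
    (E : QubitOp n) *ᵥ ψ ∈ 𝒞.codeSpace ∧ ∀ c : ℂ, (E : QubitOp n) *ᵥ ψ ≠ c • ψ

/-- `𝒞` is an `[[n, k, d]]` code: it encodes `k` qubits, i.e. its code space has dimension
`2 ^ k`, and the minimum weight of an error that maps a codeword to another codeword is `d`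
(so that there is such an error, which means `k ≥ 1`). -/
def HasParameters (𝒞 : StabilizerCode n) (k d : ℕ) : Prop :=
  Module.finrank ℂ 𝒞.codeSpace = 2 ^ k ∧
    IsLeast {e : ℕ | ∃ E, 𝒞.IsLogicalError E ∧ pauliWeight E = e} d

end StabilizerCode

/-- An implementation of a stabilizer code as a qLDPC code in the stacked architecture, with
constants `A`, `r`, `w`, `b`.

The `n` qubits are placed at distinct points of the plane with pairwise distance at least `1`,
inside a square of side length `A √n` (such as a `√n × √n` lattice). The stabilizer group has a
finite list of generators, each acting on at most `w` qubits. The generators are distributed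
over layers `0, 1, 2, …`, and only layers `i` whose scale `2 ^ i` does not exceed that side length
are used. A generator in layer `i` acts inside a ball of radius `r 2 ^ i`, and the balls of one
layer form a partition of the plane up to bounded overlaps: every point of the plane is in at
most `b` of them, counted with multiplicity. -/
structure StackedImplementation (A r : ℝ) (w b : ℕ) {n : ℕ} (𝒞 : StabilizerCode n) where
  /-- the positions of the qubits -/
  pos : Fin n → EuclideanSpace ℝ (Fin 2)
  one_le_dist : ∀ p q, p ≠ q → 1 ≤ dist (pos p) (pos q)
  /-- the lower left corner of the square that contains the qubits -/
  corner : EuclideanSpace ℝ (Fin 2)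
  pos_mem : ∀ q j, pos q j ∈ Set.Icc (corner j) (corner j + A * √(n : ℝ))
  /-- the number of generators -/
  numGen : ℕ
  /-- the generators of the stabilizer group -/
  gen : Fin numGen → (QubitOp n)ˣ
  closure_gen : Subgroup.closure (Set.range gen) = 𝒞.stabilizer
  weight_le : ∀ g, pauliWeight (gen g) ≤ w
  /-- the layer of each generator -/
  layer : Fin numGen → ℕ
  layer_le : ∀ g, (2 : ℝ) ^ layer g ≤ A * √(n : ℝ)
  /-- the centre of the ball of each generator -/
  center : Fin numGen → EuclideanSpace ℝ (Fin 2)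
  support_subset : ∀ g, ∀ q ∈ pauliSupport (gen g),
    pos q ∈ Metric.closedBall (center g) (r * 2 ^ layer g)
  overlap_le : ∀ (i : ℕ) (x : EuclideanSpace ℝ (Fin 2)),
    {g | layer g = i ∧ x ∈ Metric.closedBall (center g) (r * 2 ^ i)}.ncard ≤ b

/-- The interactions of length at least `ℓ`: the (unordered) pairs of distinct qubits that are
both in the support of some generator and whose distance is at least `ℓ`. -/
def StackedImplementation.interactions {A r : ℝ} {w b n : ℕ} {𝒞 : StabilizerCode n}
    (I : StackedImplementation A r w b 𝒞) (ℓ : ℝ) : Set (Fin n × Fin n) :=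
  {e | e.1 < e.2 ∧ (∃ g, e.1 ∈ pauliSupport (I.gen g) ∧ e.2 ∈ pauliSupport (I.gen g)) ∧
    ℓ ≤ dist (I.pos e.1) (I.pos e.2)}

/-!
Modulo phases, a stabilizer code is an isotropic subspace `S` (`StabilizerCode.bitSpace`) of a
symplectic space over the field with two elements, of dimension `n - k`, and logical operators are
the elements of the symplectic complement of `S`. A set of qubits is `Correctable` if all logical
operators supported on it are in `S`; sets of fewer than `d` qubits are correctable. Everything
rests on the dimension formula `finrank_orthogonal_inf_supportedOn` (the cleaning lemma). It gives
an expansion lemma, `DefectLE.union_correctable`: adding a correctable region `U` to a region that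
contains the outer boundary of `U` yields no new logical operators. It also gives
`DefectLE.le_card_add`: if the qubits split into two correctable regions and a set `C`, then
`k ≤ #C`.

The geometry of the stacked architecture enters through `StackedImplementation.card_longGens_le`:
the balls of layer `i` have area proportional to `4 ^ i` and overlap boundedly, so there are
`O(n / 4 ^ i)` of them, and summation over the layers shows that `O(n / L ^ 2)` generators have
diameter at least `L`. As each of them acts on at most `w` qubits, this bounds the number of long
interactions. It also shows that at length scale `L`, all but `O(n / L ^ 2)` *bad* qubits are
touched only by short generators, so that the code is a `LocalCode` on a grid of cells of side
length `L`.

For the distance, sweep the plane column by column. If the bad qubits together with each column,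
which has `O(L √n)` qubits, are fewer than `d` qubits, then all qubits that are not bad are
correctable by the expansion lemma (`LocalCode.correctable_compl_bad`). Since the bad qubits are
correctable too, this would force `k = 0`. Hence `d = O(n / L ^ 2 + L √n)`, and `L` proportional to
`d / √n` gives `d ^ 3 = O(n ^ 2)`.

For the tradeoff, cut the plane into squares of `J × J` cells, with `J L ^ 2` a small multiple
of `d`, so that the edges of the squares have fewer than `d` qubits. Then the interiors of the
squares are correctable, by sweeping them, and so are the edges without the corners; therefore `k`
is at most the number of remaining qubits. For a random position of the grid, there are
`O(n / J ^ 2)` qubits near the corners. Regarding the bad qubits, there are two cases.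

* If `d ≤ k`, all bad qubits are discarded (`LocalCode.le_of_heavy`). Some squares contain so many
  bad qubits that they cannot be swept. Such squares contain many qubits that are touched by
  generators longer than the square, so that there are few of these squares
  (`StackedImplementation.card_heavy_le`), and they are discarded as well.
* If `k ≤ d`, there are fewer bad qubits than `d`, and the bad qubits away from the edges of the
  squares can be added to the interiors by the expansion lemma. Only a fraction `O(1 / J)` of the
  bad qubits is near the edges, and these are discarded (`LocalCode.le_of_card_bad`).

If `k d ^ 2 max(k, d) ^ 2` exceeds a multiple of `n ^ 3` and `k d` a multiple of `n`, then for a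
suitable `L` less than `k` qubits are discarded, a contradiction. If `k d = O(n)`, the tradeoff
follows from the bound on the distance. The statements on hypergraph product codes and on balanced
product codes follow from `k ^ 3 d ^ 2 = O(n ^ 3)`.
-/

open scoped Finset

/-! ### The symplectic description of Pauli operators -/

/-- The single-qubit Pauli operator `X ^ a Z ^ b`, up to a phase. -/
def Pauli.ofBits : ZMod 2 × ZMod 2 → Pauli
  | (0, 0) => .I
  | (1, 0) => .X
  | (1, 1) => .Y
  | (0, 1) => .Z

theorem Pauli.exists_ofBits (P : Pauli) : ∃ v, Pauli.ofBits v = P := by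
  cases P
  exacts [⟨(0, 0), rfl⟩, ⟨(1, 0), rfl⟩, ⟨(1, 1), rfl⟩, ⟨(0, 1), rfl⟩]

theorem Pauli.ofBits_eq_I {v : ZMod 2 × ZMod 2} : Pauli.ofBits v = .I ↔ v = 0 := by
  obtain ⟨a, b⟩ := v
  fin_cases a <;> fin_cases b <;> simp [Pauli.ofBits] <;> decide

theorem Pauli.trace_mat_ofBits {v : ZMod 2 × ZMod 2} (hv : v ≠ 0) :
    (Pauli.ofBits v).mat.trace = 0 := by
  obtain ⟨a, b⟩ := v
  fin_cases a <;> fin_cases b <;>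
    simp_all [Pauli.ofBits, Pauli.mat, Matrix.trace, Fin.sum_univ_two]
  exact absurd rfl hv

theorem Pauli.exists_ofBits_mul (u v : ZMod 2 × ZMod 2) :
    ∃ t : ℕ, (ofBits u).mat * (ofBits v).mat = Complex.I ^ t • (ofBits (u + v)).mat := by
  generalize hw : u + v = w
  obtain ⟨a, b⟩ := u
  obtain ⟨c, d⟩ := v
  obtain ⟨e, f⟩ := w
  fin_cases a <;> fin_cases b <;> fin_cases c <;> fin_cases d <;> fin_cases e <;> fin_cases f <;>
  first
    | exact absurd hw (by decide)
    | (refine ⟨0, ?_⟩; ext i j; fin_cases i <;> fin_cases j <;>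
        simp [Pauli.ofBits, Pauli.mat]; done)
    | (refine ⟨1, ?_⟩; ext i j; fin_cases i <;> fin_cases j <;>
        simp [Pauli.ofBits, Pauli.mat]; done)
    | (refine ⟨3, ?_⟩; ext i j; fin_cases i <;> fin_cases j <;>
        simp [Pauli.ofBits, Pauli.mat, pow_succ])

/-- The commutation sign of two single-qubit Pauli operators. -/
theorem Pauli.ofBits_mul_comm (u v : ZMod 2 × ZMod 2) :
    (ofBits u).mat * (ofBits v).mat =
      (-1 : ℂ) ^ (u.1 * v.2 + u.2 * v.1).val • ((ofBits v).mat * (ofBits u).mat) := by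
  have hm : (u.1 * v.2 + u.2 * v.1).val = 0 ∨ (u.1 * v.2 + u.2 * v.1).val = 1 := by
    have := ZMod.val_lt (u.1 * v.2 + u.2 * v.1)
    lia
  generalize hw : (u.1 * v.2 + u.2 * v.1).val = m at hm ⊢
  obtain ⟨a, b⟩ := u
  obtain ⟨c, d⟩ := v
  rcases hm with rfl | rfl <;>
  fin_cases a <;> fin_cases b <;> fin_cases c <;> fin_cases d <;>
  first
    | exact absurd hw (by decide)
    | (ext i j; fin_cases i <;> fin_cases j <;> simp [Pauli.ofBits, Pauli.mat])

/-- The Pauli operators on `n` qubits modulo phases, as a vector space over the field with two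
elements: the `X`-bit and the `Z`-bit of each qubit. -/
abbrev PauliVec (n : ℕ) : Type := Fin n → ZMod 2 × ZMod 2

/-- The Pauli operator without phase that has the given bits. -/
noncomputable def pauliOp {n : ℕ} (v : PauliVec n) : QubitOp n :=
  pauliString fun q => Pauli.ofBits (v q)

/-- The symplectic form on Pauli vectors; it vanishes exactly on commuting pairs. -/
def sympForm (n : ℕ) : LinearMap.BilinForm (ZMod 2) (PauliVec n) :=
  LinearMap.mk₂ (ZMod 2) (fun u v => ∑ q, ((u q).1 * (v q).2 + (u q).2 * (v q).1))
    (fun u u' v => by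
      simp only [Pi.add_apply, Prod.fst_add, Prod.snd_add, ← Finset.sum_add_distrib]
      exact Finset.sum_congr rfl fun q _ => by ring)
    (fun c u v => by
      simp only [Pi.smul_apply, Prod.smul_fst, Prod.smul_snd, smul_eq_mul, Finset.mul_sum]
      exact Finset.sum_congr rfl fun q _ => by ring)
    (fun u v v' => by
      simp only [Pi.add_apply, Prod.fst_add, Prod.snd_add, ← Finset.sum_add_distrib]
      exact Finset.sum_congr rfl fun q _ => by ring)
    (fun c u v => by
      simp only [Pi.smul_apply, Prod.smul_fst, Prod.smul_snd, smul_eq_mul, Finset.mul_sum]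
      exact Finset.sum_congr rfl fun q _ => by ring)

section
variable {n : ℕ}

theorem sympForm_apply (u v : PauliVec n) :
    sympForm n u v = ∑ q, ((u q).1 * (v q).2 + (u q).2 * (v q).1) := rfl

theorem sympForm_comm (u v : PauliVec n) : sympForm n u v = sympForm n v u := by
  simp only [sympForm_apply]
  exact Finset.sum_congr rfl fun q _ => by ring

theorem sympForm_nondegenerate : (sympForm n).Nondegenerate := by
  have key : ∀ u : PauliVec n, (∀ v, sympForm n u v = 0) → u = 0 := by
    intro u h
    funext q
    have h1 := h (Pi.single q (0, 1))
    have h2 := h (Pi.single q (1, 0))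
    rw [sympForm_apply, Finset.sum_eq_single q (by intro p _ hp; simp [hp]) (by simp)] at h1 h2
    simp at h1 h2
    exact Prod.ext h1 h2
  exact ⟨key, fun u h => key u fun v => by rw [sympForm_comm]; exact h v⟩

theorem exists_pauliOp (P : Fin n → Pauli) :
    ∃ v, (∀ q, Pauli.ofBits (v q) = P q) ∧ pauliOp v = pauliString P := by
  choose v hv using fun q => (P q).exists_ofBits
  exact ⟨v, hv, by simp [pauliOp, hv]⟩

theorem pauliOp_zero : pauliOp (0 : PauliVec n) = 1 := by
  simp [pauliOp, ← pauliString_one, Pauli.ofBits_eq_I.2]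

theorem pauliOp_mul_self (v : PauliVec n) : pauliOp v * pauliOp v = 1 := pauliString_mul_self _

theorem exists_pauliOp_mul (u v : PauliVec n) :
    ∃ t : ℕ, pauliOp u * pauliOp v = Complex.I ^ t • pauliOp (u + v) := by
  choose t h using fun q => Pauli.exists_ofBits_mul (u q) (v q)
  refine ⟨∑ q, t q, ?_⟩
  ext x y
  rw [pauliOp, pauliOp, pauliString_mul_apply]
  simp [h, pauliOp, pauliString, Finset.prod_mul_distrib, Finset.prod_pow_eq_pow_sum]

theorem neg_one_pow_val_add (a b : ZMod 2) :
    (-1 : ℂ) ^ (a + b).val = (-1) ^ a.val * (-1) ^ b.val := by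
  rw [← pow_add, ZMod.val_add, ← neg_one_pow_eq_pow_mod_two]

theorem pauliOp_mul_comm (u v : PauliVec n) :
    pauliOp u * pauliOp v = (-1 : ℂ) ^ (sympForm n u v).val • (pauliOp v * pauliOp u) := by
  have key : ∀ (s : Finset (Fin n)) (f : Fin n → ZMod 2),
      (-1 : ℂ) ^ (∑ q ∈ s, f q).val = ∏ q ∈ s, (-1 : ℂ) ^ (f q).val := by
    intro s f
    induction s using Finset.cons_induction with
    | empty => simp
    | cons a s ha ih => rw [Finset.sum_cons, Finset.prod_cons, neg_one_pow_val_add, ih]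
  ext x y
  rw [Matrix.smul_apply, pauliOp, pauliOp, pauliString_mul_apply, pauliString_mul_apply,
    sympForm_apply, key, smul_eq_mul, ← Finset.prod_mul_distrib]
  exact Finset.prod_congr rfl fun q _ => by
    rw [Pauli.ofBits_mul_comm, Matrix.smul_apply, smul_eq_mul]

theorem trace_pauliString (P : Fin n → Pauli) :
    (pauliString P).trace = ∏ q, (P q).mat.trace := by
  simp only [Matrix.trace, Matrix.diag, pauliString, Matrix.of_apply]
  rw [Finset.prod_univ_sum, Fintype.piFinset_univ]

theorem trace_pauliOp {v : PauliVec n} (hv : v ≠ 0) : (pauliOp v).trace = 0 := by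
  obtain ⟨q, hq⟩ := Function.ne_iff.mp hv
  rw [pauliOp, trace_pauliString]
  exact Finset.prod_eq_zero (Finset.mem_univ q) (Pauli.trace_mat_ofBits hq)

/-- A Pauli operator determines its bits. -/
theorem pauliOp_inj {s t : ℕ} {u v : PauliVec n}
    (h : Complex.I ^ s • pauliOp u = Complex.I ^ t • pauliOp v) : u = v := by
  by_contra huv
  obtain ⟨m, hm⟩ := exists_pauliOp_mul u v
  have h' := congrArg (fun M => (M * pauliOp v).trace) h
  have hne : u + v ≠ 0 := fun h0 => huv (by
    have : v = -v := by funext q; exact Prod.ext (ZMod.neg_eq_self_mod_two _).symm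
                          (ZMod.neg_eq_self_mod_two _).symm
    rw [this]; exact eq_neg_of_add_eq_zero_left h0)
  simp only [Matrix.smul_mul, hm, pauliOp_mul_self, Matrix.trace_smul, trace_pauliOp hne,
    Matrix.trace_one] at h'
  simp [Complex.I_ne_zero] at h'

end

/-! ### Stabilizer codes as isotropic subspaces -/

section
variable {n : ℕ}

theorem exists_bits_of_mem_pauliGroup {U : (QubitOp n)ˣ} (hU : U ∈ pauliGroup n) :
    ∃ (t : ℕ) (v : PauliVec n), (U : QubitOp n) = Complex.I ^ t • pauliOp v := by
  obtain ⟨t, P, h⟩ := hU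
  obtain ⟨v, -, hv⟩ := exists_pauliOp P
  exact ⟨t, v, by rw [hv, h]⟩

theorem mem_pauliSupport_iff {U : (QubitOp n)ˣ} {t : ℕ} {v : PauliVec n}
    (h : (U : QubitOp n) = Complex.I ^ t • pauliOp v) (q : Fin n) :
    q ∈ pauliSupport U ↔ v q ≠ 0 := by
  constructor
  · rintro ⟨s, P, hP, hq⟩ h0
    obtain ⟨u, hP', hu⟩ := exists_pauliOp P
    obtain rfl : u = v := pauliOp_inj (s := s) (t := t) (by rw [hu, ← hP, h])
    exact hq (by rw [← hP', Pauli.ofBits_eq_I.2 h0])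
  · exact fun hq => ⟨t, _, h, fun h0 => hq (Pauli.ofBits_eq_I.1 h0)⟩

namespace StabilizerCode

/-- The only scalar in a stabilizer group is `1`. -/
theorem eq_one_of_scalar (𝒞 : StabilizerCode n) {g : (QubitOp n)ˣ} (hg : g ∈ 𝒞.stabilizer)
    {t : ℕ} (h : (g : QubitOp n) = Complex.I ^ t • 1) : g = 1 := by
  have hsq : g * g ∈ 𝒞.stabilizer := mul_mem hg hg
  have hne : g ≠ -1 := fun h0 => 𝒞.neg_one_notMem (h0 ▸ hg)
  have hne' : g * g ≠ -1 := fun h0 => 𝒞.neg_one_notMem (h0 ▸ hsq)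
  have h4 : Complex.I ^ t = Complex.I ^ (t % 4) := by
    conv_lhs => rw [← Nat.div_add_mod t 4, pow_add, pow_mul, Complex.I_pow_four, one_pow, one_mul]
  rw [h4] at h
  have hlt := Nat.mod_lt t (show 4 > 0 by norm_num)
  interval_cases t % 4
  · exact Units.ext (by simpa using h)
  · exact absurd (Units.ext (by simp [h, smul_smul])) hne'
  · exact absurd (Units.ext (by simpa using h)) hne
  · exact absurd (Units.ext (by simp [h, smul_smul, pow_succ])) hne'

/-- The bits of the elements of the stabilizer group. -/
def bitSpace (𝒞 : StabilizerCode n) : Submodule (ZMod 2) (PauliVec n) where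
  carrier := {v | ∃ g ∈ 𝒞.stabilizer, ∃ t : ℕ, (g : QubitOp n) = Complex.I ^ t • pauliOp v}
  zero_mem' := ⟨1, one_mem _, 0, by simp [pauliOp_zero]⟩
  add_mem' := by
    rintro u v ⟨g, hg, s, hs⟩ ⟨h, hh, t, ht⟩
    obtain ⟨m, hm⟩ := exists_pauliOp_mul u v
    refine ⟨g * h, mul_mem hg hh, s + t + m, ?_⟩
    rw [Units.val_mul, hs, ht, smul_mul_smul_comm, hm, smul_smul, pow_add, pow_add]
  smul_mem' := by
    rintro c v hv
    obtain rfl | rfl : c = 0 ∨ c = 1 := by revert c; decide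
    · exact ⟨1, one_mem _, 0, by simp [pauliOp_zero]⟩
    · simpa using hv

/-- A stabilizer is determined by its bits. -/
theorem stabilizer_ext (𝒞 : StabilizerCode n) {g h : (QubitOp n)ˣ} (hg : g ∈ 𝒞.stabilizer)
    (hh : h ∈ 𝒞.stabilizer) {s t : ℕ} {v : PauliVec n}
    (hs : (g : QubitOp n) = Complex.I ^ s • pauliOp v)
    (ht : (h : QubitOp n) = Complex.I ^ t • pauliOp v) : g = h := by
  have h1 : g * h = 1 := 𝒞.eq_one_of_scalar (mul_mem hg hh) (t := s + t)
    (by rw [Units.val_mul, hs, ht, smul_mul_smul_comm, pauliOp_mul_self, pow_add])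
  have h2 : h * h = 1 := 𝒞.eq_one_of_scalar (mul_mem hh hh) (t := t + t)
    (by rw [Units.val_mul, ht, smul_mul_smul_comm, pauliOp_mul_self, pow_add])
  exact mul_right_cancel (h1.trans h2.symm)

theorem natCard_stabilizer (𝒞 : StabilizerCode n) :
    Finite 𝒞.stabilizer ∧
      Nat.card 𝒞.stabilizer = 2 ^ Module.finrank (ZMod 2) 𝒞.bitSpace := by
  choose t v hv using fun g : 𝒞.stabilizer => exists_bits_of_mem_pauliGroup (𝒞.le_pauliGroup g.2)
  let f : 𝒞.stabilizer → 𝒞.bitSpace := fun g => ⟨v g, g, g.2, t g, hv g⟩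
  have hf : f.Bijective := by
    constructor
    · intro g h hgh
      have e : v g = v h := congrArg Subtype.val hgh
      exact Subtype.ext (𝒞.stabilizer_ext g.2 h.2 (hv g) (by rw [e, hv h]))
    · rintro ⟨u, g, hg, s, hs⟩
      exact ⟨⟨g, hg⟩, Subtype.ext (pauliOp_inj (s := t ⟨g, hg⟩) (t := s)
        (by rw [← hs, ← hv]))⟩
  refine ⟨Finite.of_injective f hf.1, ?_⟩
  rw [Nat.card_congr (Equiv.ofBijective f hf), Module.natCard_eq_pow_finrank (K := ZMod 2)]
  simp

/-- The stabilizers commute, so their bits form an isotropic subspace. -/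
theorem bitSpace_isotropic (𝒞 : StabilizerCode n) {u v : PauliVec n} (hu : u ∈ 𝒞.bitSpace)
    {g : (QubitOp n)ˣ} {t : ℕ} (ht : (g : QubitOp n) = Complex.I ^ t • pauliOp v)
    (hg : ∀ h ∈ 𝒞.stabilizer, g * h = h * g) : sympForm n u v = 0 := by
  obtain ⟨h, hh, s, hs⟩ := hu
  have hc := congrArg (fun U : (QubitOp n)ˣ => (U : QubitOp n)) (hg h hh)
  by_contra h0
  have h1 : (sympForm n u v).val = 1 := by
    have := ZMod.val_lt (sympForm n u v)
    have := (ZMod.val_ne_zero _).2 h0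
    lia
  have h2 := pauliOp_mul_comm u v
  rw [h1] at h2
  simp only [Units.val_mul, hs, ht, smul_mul_smul_comm, h2] at hc
  rw [mul_comm (Complex.I ^ s)] at hc
  have h3 := smul_right_injective (QubitOp n)
    (mul_ne_zero (pow_ne_zero t Complex.I_ne_zero) (pow_ne_zero s Complex.I_ne_zero)) hc
  rw [pow_one, neg_one_smul] at h3
  have h4 : pauliOp v * pauliOp u = (0 : QubitOp n) :=
    Matrix.ext fun i j => self_eq_neg.1 (congrFun (congrFun h3 i) j)
  have h5 := congrArg (fun M => pauliOp v * M * pauliOp u) h4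
  simp only [← mul_assoc, pauliOp_mul_self, one_mul, mul_zero, zero_mul] at h5
  exact one_ne_zero h5

/-- The projector onto the code space: the average of the stabilizers. -/
noncomputable def projector (𝒞 : StabilizerCode n) : QubitOp n :=
  (Nat.card 𝒞.stabilizer : ℂ)⁻¹ • ∑ᶠ g : 𝒞.stabilizer, ((g : (QubitOp n)ˣ) : QubitOp n)

theorem projector_isProj (𝒞 : StabilizerCode n) :
    LinearMap.IsProj 𝒞.codeSpace (Matrix.toLin' 𝒞.projector) := by
  have := 𝒞.natCard_stabilizer.1
  have := Fintype.ofFinite 𝒞.stabilizer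
  have hc : (Nat.card 𝒞.stabilizer : ℂ) ≠ 0 := by simp
  constructor
  · intro ψ g hg
    rw [Matrix.toLin'_apply, Matrix.mulVec_mulVec, projector, Matrix.mul_smul,
      finsum_eq_sum_of_fintype, Finset.mul_sum]
    congr 2
    exact Fintype.sum_equiv (Equiv.mulLeft ⟨g, hg⟩) _ _ fun h => by simp
  · intro ψ hψ
    rw [Matrix.toLin'_apply, projector, Matrix.smul_mulVec, finsum_eq_sum_of_fintype,
      Matrix.sum_mulVec, Finset.sum_congr rfl fun g _ => hψ g.1 g.2]
    rw [Finset.sum_const, Finset.card_univ, ← Nat.card_eq_fintype_card, ← Nat.cast_smul_eq_nsmul ℂ,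
      smul_smul, inv_mul_cancel₀ hc, one_smul]

/-- An operator without component in the stabilizer group has trace zero on the code space. -/
theorem trace_pauliOp_mul_projector (𝒞 : StabilizerCode n) {v : PauliVec n}
    (hv : v ∉ 𝒞.bitSpace) : (pauliOp v * 𝒞.projector).trace = 0 := by
  have := 𝒞.natCard_stabilizer.1
  have := Fintype.ofFinite 𝒞.stabilizer
  rw [projector, Matrix.mul_smul, finsum_eq_sum_of_fintype, Finset.mul_sum, Matrix.trace_smul,
    Matrix.trace_sum, Finset.sum_eq_zero, smul_zero]
  rintro g -
  obtain ⟨t, u, hu⟩ := exists_bits_of_mem_pauliGroup (𝒞.le_pauliGroup g.2)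
  obtain ⟨m, hm⟩ := exists_pauliOp_mul v u
  rw [hu, Matrix.mul_smul, hm, Matrix.trace_smul, Matrix.trace_smul, trace_pauliOp, smul_zero,
    smul_zero]
  intro h0
  have hmem : u ∈ 𝒞.bitSpace := ⟨g, g.2, t, hu⟩
  exact hv (by rw [eq_neg_of_add_eq_zero_left h0]; exact neg_mem hmem)

theorem trace_projector (𝒞 : StabilizerCode n) :
    𝒞.projector.trace * Nat.card 𝒞.stabilizer = 2 ^ n := by
  have := 𝒞.natCard_stabilizer.1
  have := Fintype.ofFinite 𝒞.stabilizer
  have hc : (Nat.card 𝒞.stabilizer : ℂ) ≠ 0 := by simp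
  rw [projector, finsum_eq_sum_of_fintype, Matrix.trace_smul, Matrix.trace_sum,
    Finset.sum_eq_single 1]
  · rw [smul_eq_mul, mul_right_comm, inv_mul_cancel₀ hc]
    simp [Matrix.trace_one]
  · rintro g - hg
    obtain ⟨t, u, hu⟩ := exists_bits_of_mem_pauliGroup (𝒞.le_pauliGroup g.2)
    rw [hu, Matrix.trace_smul, trace_pauliOp, smul_zero]
    rintro rfl
    exact hg (Subtype.ext (𝒞.eq_one_of_scalar g.2 (by rw [hu, pauliOp_zero])))
  · simp

theorem trace_projector_eq_finrank (𝒞 : StabilizerCode n) :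
    𝒞.projector.trace = Module.finrank ℂ 𝒞.codeSpace := by
  rw [← 𝒞.projector_isProj.trace, Matrix.trace_toLin'_eq]

theorem finrank_bitSpace_add {𝒞 : StabilizerCode n} {k : ℕ}
    (hk : Module.finrank ℂ 𝒞.codeSpace = 2 ^ k) :
    Module.finrank (ZMod 2) 𝒞.bitSpace + k = n := by
  have h := 𝒞.trace_projector
  rw [trace_projector_eq_finrank, hk, 𝒞.natCard_stabilizer.2] at h
  have h' : 2 ^ (k + Module.finrank (ZMod 2) 𝒞.bitSpace) = 2 ^ n := by
    rw [pow_add]; exact_mod_cast h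
  have := Nat.pow_right_injective le_rfl h'
  lia

/-- A Pauli operator that commutes with every stabilizer without being one of them, up to a
phase, is a logical error. -/
theorem isLogicalError_of_notMem {𝒞 : StabilizerCode n} (hpos : 0 < Module.finrank ℂ 𝒞.codeSpace)
    {v : PauliVec n} (hv : v ∈ (sympForm n).orthogonal 𝒞.bitSpace) (hv' : v ∉ 𝒞.bitSpace)
    (E : (QubitOp n)ˣ) (hE : (E : QubitOp n) = pauliOp v) : 𝒞.IsLogicalError E := by
  have hcode : ∀ ψ ∈ 𝒞.codeSpace, (E : QubitOp n) *ᵥ ψ ∈ 𝒞.codeSpace := by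
    intro ψ hψ g hg
    obtain ⟨t, u, hu⟩ := exists_bits_of_mem_pauliGroup (𝒞.le_pauliGroup hg)
    have h0 : sympForm n u v = 0 := hv u ⟨g, hg, t, hu⟩
    have hc : (g : QubitOp n) * E = E * g := by
      rw [hu, hE, Matrix.smul_mul, pauliOp_mul_comm, h0]
      simp
    rw [Matrix.mulVec_mulVec, hc, ← Matrix.mulVec_mulVec, hψ g hg]
  refine ⟨⟨0, _, by rw [hE, pow_zero, one_smul]; rfl⟩, ?_⟩
  by_contra! hcon
  let f : 𝒞.codeSpace →ₗ[ℂ] 𝒞.codeSpace := (Matrix.toLin' (E : QubitOp n)).restrict hcode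
  have hf : ∀ ψ, (f ψ : (Fin n → Fin 2) → ℂ) = (E : QubitOp n) *ᵥ ψ := fun _ => rfl
  obtain ⟨c, hc⟩ := LinearMap.exists_eq_smul_id_of_forall_notLinearIndependent (f := f) (by
    rintro ⟨ψ, hψ⟩ hli
    obtain ⟨c, hc⟩ := hcon ψ hψ (hcode ψ hψ)
    have := LinearIndependent.pair_iff.1 hli c (-1) (by
      apply Subtype.ext
      simp [hf, hc])
    simp at this)
  have hproj : (E : QubitOp n) * 𝒞.projector = c • 𝒞.projector := by
    apply Matrix.toLin'.injective
    refine LinearMap.ext fun ψ => ?_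
    have h1 := congrArg Subtype.val
      (LinearMap.congr_fun hc ⟨_, 𝒞.projector_isProj.map_mem ψ⟩)
    rw [hf] at h1
    simpa using h1
  have htr := congrArg Matrix.trace hproj
  rw [hE, 𝒞.trace_pauliOp_mul_projector hv', Matrix.trace_smul, trace_projector_eq_finrank] at htr
  have hc0 : c = 0 := by
    rcases smul_eq_zero.1 htr.symm with h | h
    · exact h
    · exact absurd (by exact_mod_cast h) hpos.ne'
  rw [hc0, zero_smul] at hproj
  have hp0 : 𝒞.projector = 0 := by
    rw [← one_mul 𝒞.projector, ← E.inv_mul, mul_assoc, hproj, mul_zero]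
  have := 𝒞.trace_projector_eq_finrank
  rw [hp0, Matrix.trace_zero] at this
  exact hpos.ne (by exact_mod_cast this)

end StabilizerCode
end

/-! ### Correctable regions -/

section
variable {n : ℕ}

/-- The Pauli vectors whose support is contained in `M`. -/
def supportedOn (M : Finset (Fin n)) : Submodule (ZMod 2) (PauliVec n) where
  carrier := {v | ∀ q ∉ M, v q = 0}
  zero_mem' := fun _ _ => rfl
  add_mem' := fun hu hv q hq => by simp [hu q hq, hv q hq]
  smul_mem' := fun c v hv q hq => by simp [hv q hq]

theorem mem_supportedOn {M : Finset (Fin n)} {v : PauliVec n} :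
    v ∈ supportedOn M ↔ ∀ q ∉ M, v q = 0 := Iff.rfl

theorem supportedOn_mono {M N : Finset (Fin n)} (h : M ⊆ N) : supportedOn M ≤ supportedOn N :=
  fun _ hv q hq => hv q fun hM => hq (h hM)

theorem finrank_supportedOn (M : Finset (Fin n)) :
    Module.finrank (ZMod 2) (supportedOn M) = 2 * M.card := by
  let f : PauliVec n →ₗ[ZMod 2] ({q // q ∉ M} → ZMod 2 × ZMod 2) :=
    LinearMap.funLeft (ZMod 2) (ZMod 2 × ZMod 2) Subtype.val
  have hf : LinearMap.ker f = supportedOn M := by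
    ext v
    rw [LinearMap.mem_ker, mem_supportedOn, funext_iff]
    exact ⟨fun h q hq => h ⟨q, hq⟩, fun h q => h q.1 q.2⟩
  have h := f.finrank_range_add_finrank_ker
  rw [hf, LinearMap.range_eq_top.2
    (LinearMap.funLeft_surjective_of_injective _ _ _ Subtype.val_injective), finrank_top,
    Module.finrank_pi_fintype, Module.finrank_pi_fintype] at h
  simp only [Module.finrank_prod, Module.finrank_self, Finset.sum_const, Finset.card_univ,
    smul_eq_mul, Fintype.card_fin] at h
  rw [Fintype.card_subtype_compl, Fintype.card_fin, Fintype.card_coe] at h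
  have := M.card_le_univ
  rw [Fintype.card_fin] at this
  lia

theorem sympForm_eq_zero_of_disjoint {u v : PauliVec n} (h : ∀ q, u q = 0 ∨ v q = 0) :
    sympForm n u v = 0 := by
  rw [sympForm_apply]
  refine Finset.sum_eq_zero fun q _ => ?_
  rcases h q with h | h <;> simp [h]

theorem orthogonal_supportedOn (M : Finset (Fin n)) :
    (sympForm n).orthogonal (supportedOn M) = supportedOn Mᶜ := by
  ext v
  constructor
  · intro h q hq
    have hq : q ∈ M := by simpa using hq
    have key : ∀ c : ZMod 2 × ZMod 2, c.1 * (v q).2 + c.2 * (v q).1 = 0 := by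
      intro c
      have hc := h (Pi.single q c) fun p hp => by
        rw [Pi.single_eq_of_ne]; rintro rfl; exact hp hq
      rwa [sympForm_apply,
        Finset.sum_eq_single q (by intro p _ hp; simp [hp]) (by simp), Pi.single_eq_same] at hc
    exact Prod.ext (by simpa using key (0, 1)) (by simpa using key (1, 0))
  · intro h u hu
    refine sympForm_eq_zero_of_disjoint fun q => ?_
    by_cases hq : q ∈ M
    · exact Or.inr (h q (by simpa using hq))
    · exact Or.inl (hu q hq)

theorem orthogonal_sup (X Y : Submodule (ZMod 2) (PauliVec n)) :
    (sympForm n).orthogonal (X ⊔ Y) =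
      (sympForm n).orthogonal X ⊓ (sympForm n).orthogonal Y := by
  refine le_antisymm (le_inf (LinearMap.BilinForm.orthogonal_le le_sup_left)
    (LinearMap.BilinForm.orthogonal_le le_sup_right)) ?_
  rintro v ⟨hX, hY⟩ u hu
  obtain ⟨x, hx, y, hy, rfl⟩ := Submodule.mem_sup.1 hu
  have h1 : sympForm n x v = 0 := hX x hx
  have h2 : sympForm n y v = 0 := hY y hy
  rw [map_add, LinearMap.add_apply, h1, h2, add_zero]

/-- A region is correctable for the stabilizer space `S` if every logical operator supported on it
is a stabilizer. Here logical operators are the elements of the symplectic complement of `S`. -/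
def Correctable (S : Submodule (ZMod 2) (PauliVec n)) (M : Finset (Fin n)) : Prop :=
  ∀ v ∈ (sympForm n).orthogonal S, v ∈ supportedOn M → v ∈ S

variable {S : Submodule (ZMod 2) (PauliVec n)} {ι : Type*} {Γ : ι → PauliVec n}

theorem Correctable.mono {M N : Finset (Fin n)} (h : Correctable S N) (hMN : M ⊆ N) :
    Correctable S M := fun v hv hM => h v hv (supportedOn_mono hMN hM)

theorem mem_orthogonal_span_iff (hΓ : Submodule.span (ZMod 2) (Set.range Γ) = S)
    {v : PauliVec n} : v ∈ (sympForm n).orthogonal S ↔ ∀ i, sympForm n (Γ i) v = 0 := by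
  constructor
  · exact fun h i => h _ (hΓ ▸ Submodule.subset_span ⟨i, rfl⟩)
  · intro h u hu
    rw [← hΓ] at hu
    induction hu using Submodule.span_induction with
    | mem x hx => obtain ⟨i, rfl⟩ := hx; exact h i
    | zero => simp
    | add x y _ _ hx hy => rw [map_add, LinearMap.add_apply, hx, hy, add_zero]
    | smul c x _ hx => rw [map_smul, LinearMap.smul_apply, hx, smul_zero]

/-- The part of a Pauli vector on a region. -/
def restrictTo (v : PauliVec n) (M : Finset (Fin n)) : PauliVec n :=
  fun q => if q ∈ M then v q else 0

theorem restrictTo_mem (v : PauliVec n) (M : Finset (Fin n)) : restrictTo v M ∈ supportedOn M :=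
  fun _ hq => if_neg hq

/-- If `M` contains, for each generator, all or none of the qubits that the generator shares with
a logical operator, then the part of that operator on `M` is a logical operator. -/
theorem restrictTo_mem_orthogonal (hΓ : Submodule.span (ZMod 2) (Set.range Γ) = S)
    {v : PauliVec n} (hv : v ∈ (sympForm n).orthogonal S) {M : Finset (Fin n)}
    (h : ∀ i, (∀ q, v q ≠ 0 → Γ i q ≠ 0 → q ∈ M) ∨ (∀ q, v q ≠ 0 → Γ i q ≠ 0 → q ∉ M)) :
    restrictTo v M ∈ (sympForm n).orthogonal S := by
  rw [mem_orthogonal_span_iff hΓ] at hv ⊢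
  intro i
  rcases h i with h | h
  · rw [← hv i, sympForm_apply, sympForm_apply]
    refine Finset.sum_congr rfl fun q _ => ?_
    by_cases hq : q ∈ M
    · simp [restrictTo, hq]
    · by_cases h1 : v q = 0
      · simp [restrictTo, h1]
      · by_cases h2 : Γ i q = 0
        · simp [h2]
        · exact absurd (h q h1 h2) hq
  · refine sympForm_eq_zero_of_disjoint fun q => ?_
    by_cases hq : q ∈ M
    · by_cases h1 : v q = 0
      · exact Or.inr (by simp [restrictTo, h1])
      · exact Or.inl (by_contra fun h2 => h q h1 h2 hq)
    · exact Or.inr (by simp [restrictTo, hq])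

/-- A region is correctable if it splits into correctable pieces such that no generator touches
two of them. -/
theorem correctable_of_pieces (hΓ : Submodule.span (ZMod 2) (Set.range Γ) = S)
    {κ : Type*} [DecidableEq κ] {M : Finset (Fin n)} (piece : Fin n → κ)
    (h : ∀ i, ∀ p ∈ M, ∀ q ∈ M, Γ i p ≠ 0 → Γ i q ≠ 0 → piece p = piece q)
    (hc : ∀ c, Correctable S {q ∈ M | piece q = c}) : Correctable S M := by
  intro v hv hvM
  have hsum : v = ∑ c ∈ M.image piece, restrictTo v {q ∈ M | piece q = c} := by
    funext q
    rw [Finset.sum_apply]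
    by_cases hq : q ∈ M
    · rw [Finset.sum_eq_single (piece q)]
      · simp [restrictTo, hq]
      · intro c _ hcq
        simp [restrictTo, hcq.symm]
      · exact fun h' => absurd (Finset.mem_image_of_mem piece hq) h'
    · simp [restrictTo, hq, hvM q hq]
  rw [hsum]
  refine Submodule.sum_mem _ fun c _ => hc c _ (restrictTo_mem_orthogonal hΓ hv fun i => ?_)
    (restrictTo_mem _ _)
  have hM : ∀ q, v q ≠ 0 → q ∈ M := fun q hq => by_contra fun h' => hq (hvM q h')
  by_cases hi : ∃ p, v p ≠ 0 ∧ Γ i p ≠ 0 ∧ piece p = c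
  · obtain ⟨p, hp, hpi, rfl⟩ := hi
    exact Or.inl fun q hq hqi => by simp [hM q hq, h i q (hM q hq) p (hM p hp) hqi hpi]
  · push Not at hi
    exact Or.inr fun q hq hqi => by simp [hi q hq hqi]

/-- The cleaning lemma: the number of independent logical operators supported on `M` is determined
by the number of independent stabilizers that avoid `M`. -/
theorem finrank_orthogonal_inf_supportedOn (S : Submodule (ZMod 2) (PauliVec n))
    (M : Finset (Fin n)) :
    Module.finrank (ZMod 2) ↥((sympForm n).orthogonal S ⊓ supportedOn M) +
        Module.finrank (ZMod 2) S =
      2 * M.card + Module.finrank (ZMod 2) ↥(S ⊓ supportedOn Mᶜ) := by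
  have h1 : (sympForm n).orthogonal S ⊓ supportedOn M =
      (sympForm n).orthogonal (S ⊔ supportedOn Mᶜ) := by
    rw [orthogonal_sup, orthogonal_supportedOn, compl_compl]
  have h2 := Submodule.finrank_sup_add_finrank_inf_eq S (supportedOn Mᶜ)
  have h3 := LinearMap.BilinForm.finrank_add_finrank_orthogonal'
    (B := sympForm n) (S ⊔ supportedOn Mᶜ)
  rw [sympForm_nondegenerate.ker_eq_bot, inf_bot_eq, finrank_bot, add_zero, ← h1] at h3
  rw [finrank_supportedOn, Finset.card_compl, Fintype.card_fin] at h2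
  have h4 : Module.finrank (ZMod 2) (PauliVec n) = 2 * n := by
    rw [Module.finrank_pi_fintype]; simp [mul_comm]
  have := M.card_le_univ
  rw [Fintype.card_fin] at this
  lia

/-- At most `e` independent logical operators, modulo stabilizers, are supported on `M`. -/
def DefectLE (S : Submodule (ZMod 2) (PauliVec n)) (M : Finset (Fin n)) (e : ℕ) : Prop :=
  Module.finrank (ZMod 2) ↥((sympForm n).orthogonal S ⊓ supportedOn M) ≤
    Module.finrank (ZMod 2) ↥(S ⊓ supportedOn M) + e

theorem defectLE_zero_iff (hS : S ≤ (sympForm n).orthogonal S) {M : Finset (Fin n)} :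
    DefectLE S M 0 ↔ Correctable S M := by
  constructor
  · intro h v hv hvM
    have := Submodule.eq_of_le_of_finrank_le (inf_le_inf_right (supportedOn M) hS) h
    exact (this.ge ⟨hv, hvM⟩).1
  · intro h
    exact Submodule.finrank_mono (le_inf (fun v hv => h v hv.1 hv.2) inf_le_right)

/-- Each additional qubit supports at most two further independent logical operators. -/
theorem DefectLE.union_card {M : Finset (Fin n)} {e : ℕ} (h : DefectLE S M e)
    (N : Finset (Fin n)) : DefectLE S (M ∪ N) (e + 2 * N.card) := by
  have h1 := finrank_orthogonal_inf_supportedOn S M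
  have h2 := finrank_orthogonal_inf_supportedOn S (M ∪ N)
  have h3 : Module.finrank (ZMod 2) ↥(S ⊓ supportedOn M) ≤
      Module.finrank (ZMod 2) ↥(S ⊓ supportedOn (M ∪ N)) :=
    Submodule.finrank_mono (inf_le_inf_left _ (supportedOn_mono Finset.subset_union_left))
  have h4 : Module.finrank (ZMod 2) ↥(S ⊓ supportedOn (M ∪ N)ᶜ) ≤
      Module.finrank (ZMod 2) ↥(S ⊓ supportedOn Mᶜ) :=
    Submodule.finrank_mono (inf_le_inf_left _
      (supportedOn_mono (Finset.compl_subset_compl.2 Finset.subset_union_left)))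
  have h5 := Finset.card_union_le M N
  unfold DefectLE at h ⊢
  lia

/-- The expansion lemma: adding a correctable region `U` to a region `T` that contains the outer
boundary of `U` yields no new logical operators. Indeed, let a logical operator avoid `T`. Its
part on `U` is decoupled from the rest, hence a stabilizer, so the operator has a representative
that avoids `U ∪ T`. By the cleaning lemma, that is `finrank_orthogonal_inf_supportedOn`, the
number of independent logical operators that avoid a region determines the number of those
supported on it. -/
theorem DefectLE.union_correctable (hΓ : Submodule.span (ZMod 2) (Set.range Γ) = S)
    (hS : S ≤ (sympForm n).orthogonal S) {U T : Finset (Fin n)} {e : ℕ} (hT : DefectLE S T e)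
    (hU : Correctable S U)
    (h : ∀ i, ∀ p ∈ U, Γ i p ≠ 0 → ∀ q, Γ i q ≠ 0 → q ∈ U ∪ T) : DefectLE S (U ∪ T) e := by
  have hsub : supportedOn (U ∪ T)ᶜ ≤ supportedOn Tᶜ :=
    supportedOn_mono (Finset.compl_subset_compl.2 Finset.subset_union_right)
  have hclean : (sympForm n).orthogonal S ⊓ supportedOn Tᶜ ≤
      S ⊓ supportedOn Tᶜ ⊔ (sympForm n).orthogonal S ⊓ supportedOn (U ∪ T)ᶜ := by
    rintro u ⟨hu, huT⟩
    have huU : restrictTo u U ∈ S := by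
      refine hU _ (restrictTo_mem_orthogonal hΓ hu fun i => ?_) (restrictTo_mem _ _)
      by_cases hi : ∃ p ∈ U, Γ i p ≠ 0
      · obtain ⟨p, hp, hpi⟩ := hi
        left
        intro q hq hqi
        rcases Finset.mem_union.1 (h i p hp hpi q hqi) with h' | h'
        · exact h'
        · exact absurd (huT q (by simpa using h')) hq
      · push Not at hi
        exact Or.inr fun q _ hqi hqU => hqi (hi q hqU)
    have hTU : restrictTo u U ∈ supportedOn Tᶜ := fun q hq => by
      simp [restrictTo, huT q hq]
    rw [← add_sub_cancel (restrictTo u U) u]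
    refine Submodule.add_mem_sup ⟨huU, hTU⟩ ⟨sub_mem hu (hS huU), fun q hq => ?_⟩
    rw [Finset.notMem_compl, Finset.mem_union] at hq
    by_cases hqU : q ∈ U
    · simp [restrictTo, hqU]
    · simp [restrictTo, hqU, huT q (by simpa using hq.resolve_left hqU)]
  have h1 := Submodule.finrank_mono hclean
  have h2 := Submodule.finrank_sup_add_finrank_inf_eq (S ⊓ supportedOn Tᶜ)
    ((sympForm n).orthogonal S ⊓ supportedOn (U ∪ T)ᶜ)
  have h3 : S ⊓ supportedOn Tᶜ ⊓ ((sympForm n).orthogonal S ⊓ supportedOn (U ∪ T)ᶜ) =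
      S ⊓ supportedOn (U ∪ T)ᶜ :=
    le_antisymm (fun v hv => ⟨hv.1.1, hv.2.2⟩) fun v hv => ⟨⟨hv.1, hsub hv.2⟩, hS hv.1, hv.2⟩
  rw [h3] at h2
  have h4 := finrank_orthogonal_inf_supportedOn S T
  have h5 := finrank_orthogonal_inf_supportedOn S Tᶜ
  have h6 := finrank_orthogonal_inf_supportedOn S (U ∪ T)
  have h7 := finrank_orthogonal_inf_supportedOn S (U ∪ T)ᶜ
  have h8 := T.card_le_univ
  have h9 := (U ∪ T).card_le_univ
  rw [compl_compl, Finset.card_compl] at h5 h7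
  unfold DefectLE at hT ⊢
  lia

/-- The union of a correctable region with a correctable region that contains its outer boundary
is correctable. -/
theorem Correctable.union (hΓ : Submodule.span (ZMod 2) (Set.range Γ) = S)
    (hS : S ≤ (sympForm n).orthogonal S) {U T : Finset (Fin n)} (hU : Correctable S U)
    (hT : Correctable S T)
    (h : ∀ i, ∀ p ∈ U, Γ i p ≠ 0 → ∀ q, Γ i q ≠ 0 → q ∈ U ∪ T) : Correctable S (U ∪ T) :=
  (defectLE_zero_iff hS).1 (((defectLE_zero_iff hS).2 hT).union_correctable hΓ hS hU h)

/-- If two disjoint regions support few logical operators, then the rest `C` of the qubits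
carries almost all logical qubits. -/
theorem DefectLE.le_card_add {k : ℕ} (hk : Module.finrank (ZMod 2) S + k = n)
    {M N C : Finset (Fin n)} {e : ℕ} (hM : DefectLE S M (2 * e))
    (hN : DefectLE S N 0) (hMN : Disjoint M N) (hC : ∀ q, q ∈ M ∨ q ∈ N ∨ q ∈ C) :
    k ≤ C.card + e := by
  have h1 := finrank_orthogonal_inf_supportedOn S M
  have h2 := finrank_orthogonal_inf_supportedOn S N
  have h3 : Module.finrank (ZMod 2) ↥(S ⊓ supportedOn N) ≤
      Module.finrank (ZMod 2) ↥(S ⊓ supportedOn Mᶜ) :=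
    Submodule.finrank_mono (inf_le_inf_left _ (supportedOn_mono hMN.symm.le_compl_right))
  have h4 : Module.finrank (ZMod 2) ↥(S ⊓ supportedOn M) ≤
      Module.finrank (ZMod 2) ↥(S ⊓ supportedOn Nᶜ) :=
    Submodule.finrank_mono (inf_le_inf_left _ (supportedOn_mono hMN.le_compl_right))
  have h5 : (Finset.univ : Finset (Fin n)) ⊆ M ∪ (N ∪ C) := fun q _ => by simpa using hC q
  have h6 := Finset.card_le_card h5
  have h7 := Finset.card_union_le M (N ∪ C)
  have h8 := Finset.card_union_le N C
  rw [Finset.card_univ, Fintype.card_fin] at h6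
  unfold DefectLE at hM hN
  lia

namespace StabilizerCode

theorem bitSpace_le_orthogonal (𝒞 : StabilizerCode n) :
    𝒞.bitSpace ≤ (sympForm n).orthogonal 𝒞.bitSpace := by
  rintro v ⟨g, hg, t, ht⟩ u hu
  exact 𝒞.bitSpace_isotropic hu ht fun h hh => 𝒞.comm g hg h hh

/-- Regions with fewer qubits than the distance are correctable. -/
theorem HasParameters.correctable {𝒞 : StabilizerCode n} {k d : ℕ} (h : 𝒞.HasParameters k d)
    {M : Finset (Fin n)} (hM : M.card < d) : Correctable 𝒞.bitSpace M := by
  intro v hv hvM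
  by_contra hv'
  let E : (QubitOp n)ˣ := ⟨pauliOp v, pauliOp v, pauliOp_mul_self v, pauliOp_mul_self v⟩
  have hE := isLogicalError_of_notMem (by rw [h.1]; positivity) hv hv' E rfl
  have h1 : d ≤ pauliWeight E := h.2.2 ⟨E, hE, rfl⟩
  have h2 : pauliSupport E ⊆ M := fun q hq => by
    rw [mem_pauliSupport_iff (t := 0) (v := v) (by simp [E])] at hq
    exact by_contra fun hq' => hq (hvM q hq')
  have h3 : pauliWeight E ≤ M.card := by
    rw [← Set.ncard_coe_finset]
    exact Set.ncard_le_ncard h2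
  lia

theorem HasParameters.one_le_k {𝒞 : StabilizerCode n} {k d : ℕ} (h : 𝒞.HasParameters k d) :
    1 ≤ k := by
  by_contra hk
  obtain rfl : k = 0 := by lia
  obtain ⟨⟨E, ⟨-, ψ, hψ, hEψ, hne⟩, -⟩, -⟩ := h.2
  have hψ0 : (⟨ψ, hψ⟩ : 𝒞.codeSpace) ≠ 0 := by
    intro h0
    have : ψ = 0 := congrArg Subtype.val h0
    exact hne 0 (by simp [this])
  obtain ⟨c, hc⟩ := (finrank_eq_one_iff_of_nonzero' _ hψ0).1 h.1 ⟨_, hEψ⟩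
  exact hne c (congrArg Subtype.val hc).symm

/-- Bits of a generating set of the stabilizer group. -/
theorem exists_bits_gen {𝒞 : StabilizerCode n} {gen : ι → (QubitOp n)ˣ}
    (hgen : Subgroup.closure (Set.range gen) = 𝒞.stabilizer) :
    ∃ Γ : ι → PauliVec n, (∀ i q, q ∈ pauliSupport (gen i) ↔ Γ i q ≠ 0) ∧
      Submodule.span (ZMod 2) (Set.range Γ) = 𝒞.bitSpace := by
  have hmem : ∀ i, gen i ∈ 𝒞.stabilizer := fun i => hgen ▸ Subgroup.subset_closure ⟨i, rfl⟩
  choose t Γ hΓ using fun i => exists_bits_of_mem_pauliGroup (𝒞.le_pauliGroup (hmem i))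
  refine ⟨Γ, fun i q => mem_pauliSupport_iff (hΓ i) q, le_antisymm ?_ ?_⟩
  · rw [Submodule.span_le]
    rintro _ ⟨i, rfl⟩
    exact ⟨gen i, hmem i, t i, hΓ i⟩
  · have key : ∀ g ∈ Subgroup.closure (Set.range gen), ∃ (s : ℕ) (v : PauliVec n),
        v ∈ Submodule.span (ZMod 2) (Set.range Γ) ∧
          (g : QubitOp n) = Complex.I ^ s • pauliOp v := by
      intro g hg
      induction hg using Subgroup.closure_induction with
      | mem x hx =>
        obtain ⟨i, rfl⟩ := hx
        exact ⟨t i, Γ i, Submodule.subset_span ⟨i, rfl⟩, hΓ i⟩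
      | one => exact ⟨0, 0, zero_mem _, by simp [pauliOp_zero]⟩
      | mul x y _ _ hx hy =>
        obtain ⟨s, u, hu, hs⟩ := hx
        obtain ⟨m, v, hv, hm⟩ := hy
        obtain ⟨l, hl⟩ := exists_pauliOp_mul u v
        refine ⟨s + m + l, u + v, add_mem hu hv, ?_⟩
        rw [Units.val_mul, hs, hm, smul_mul_smul_comm, hl, smul_smul, pow_add, pow_add]
      | inv x _ hx =>
        obtain ⟨s, u, hu, hs⟩ := hx
        refine ⟨3 * s, u, hu, ?_⟩
        rw [Units.inv_eq_of_mul_eq_one_right]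
        rw [hs, smul_mul_smul_comm, pauliOp_mul_self, ← pow_add,
          show s + 3 * s = 4 * s by ring, pow_mul, Complex.I_pow_four, one_pow, one_smul]
    rintro v ⟨g, hg, s, hs⟩
    obtain ⟨s', v', hv', hs'⟩ := key g (hgen ▸ hg)
    rwa [pauliOp_inj (hs.symm.trans hs')]

end StabilizerCode
end

/-! ### Codes that are local up to a few bad qubits -/

/-- A stabilizer space with distance at least `d` whose qubits sit in the cells `(x q, y q)` of a
square grid. Away from the set `bad`, it is local: a generator `Γ i` that touches a qubit outside
`bad` acts within neighbouring cells. -/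
structure LocalCode (n d : ℕ) where
  /-- the bits of the stabilizers -/
  S : Submodule (ZMod 2) (PauliVec n)
  /-- the index type of the generators -/
  ι : Type
  /-- the bits of the generators -/
  Γ : ι → PauliVec n
  span_eq : Submodule.span (ZMod 2) (Set.range Γ) = S
  isotropic : S ≤ (sympForm n).orthogonal S
  correctable_of_card_lt : ∀ M : Finset (Fin n), M.card < d → Correctable S M
  /-- the column of a qubit -/
  x : Fin n → ℤ
  /-- the row of a qubit -/
  y : Fin n → ℤ
  /-- the qubits that may be touched by long-range generators -/
  bad : Finset (Fin n)
  local_x : ∀ i p q, Γ i p ≠ 0 → Γ i q ≠ 0 → p ∉ bad → |x p - x q| ≤ 1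
  local_y : ∀ i p q, Γ i p ≠ 0 → Γ i q ≠ 0 → p ∉ bad → |y p - y q| ≤ 1

namespace LocalCode
variable {n d : ℕ} (H : LocalCode n d)

/-- A region is correctable if it can be swept column by column such that the boundary of the
part that has been swept always has fewer than `d` qubits. -/
theorem correctable_of_sweep (Z : Finset (Fin n)) (T : ℤ → Finset (Fin n))
    (hT : ∀ j, (T j).card < d) (hZ : ∀ q ∈ Z, q ∈ T (H.x q))
    (hb : ∀ j i p, p ∈ Z → H.x p < j → H.Γ i p ≠ 0 → ∀ q, H.Γ i q ≠ 0 →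
      (q ∈ Z ∧ H.x q < j) ∨ q ∈ T j) : Correctable H.S Z := by
  obtain ⟨m, hm⟩ : ∃ m : ℤ, ∀ q, m ≤ H.x q := by
    obtain ⟨m, hm⟩ := (Set.finite_range H.x).bddBelow
    exact ⟨m, fun q => hm ⟨q, rfl⟩⟩
  obtain ⟨M, hM⟩ : ∃ M : ℤ, ∀ q, H.x q ≤ M := by
    obtain ⟨M, hM⟩ := (Set.finite_range H.x).bddAbove
    exact ⟨M, fun q => hM ⟨q, rfl⟩⟩
  have key : ∀ j : ℕ, Correctable H.S {q ∈ Z | H.x q < m + j} := by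
    intro j
    induction j with
    | zero =>
      refine H.correctable_of_card_lt _ ?_
      rw [Finset.filter_eq_empty_iff.2 fun q _ => by simpa using hm q]
      exact (Nat.zero_le _).trans_lt (hT 0)
    | succ j ih =>
      refine (ih.union H.span_eq H.isotropic (H.correctable_of_card_lt _ (hT (m + j)))
        fun i p hp hpi q hqi => ?_).mono fun q hq => ?_
      · rw [Finset.mem_filter] at hp
        simpa using hb _ i p hp.1 hp.2 hpi q hqi
      · simp only [Finset.mem_filter, Nat.cast_succ, Finset.mem_union] at hq ⊢
        by_cases h : H.x q < m + j
        · exact Or.inl ⟨hq.1, h⟩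
        · have : H.x q = m + j := by lia
          exact Or.inr (this ▸ hZ q hq.1)
  refine (key (M + 1 - m).toNat).mono fun q hq => ?_
  have := hM q
  have := hm q
  simp only [Finset.mem_filter, hq, true_and]
  lia

/-- If the bad qubits together with any column are fewer than `d` qubits, then all other qubits
are simultaneously correctable. -/
theorem correctable_compl_bad (h : ∀ j, H.bad.card + #{q | H.x q = j} < d) :
    Correctable H.S H.badᶜ := by
  refine H.correctable_of_sweep _ (fun j => H.bad ∪ ({q | H.x q = j} : Finset (Fin n)))
    (fun j => (Finset.card_union_le _ _).trans_lt (h j)) (fun q _ => by simp) ?_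
  intro j i p hp hpj hpi q hqi
  have := abs_le.1 (H.local_x i p q hpi hqi (by simpa using hp))
  by_cases hq : q ∈ H.bad
  · simp [hq]
  · by_cases hj : H.x q = j
    · simp [hj]
    · exact Or.inl ⟨by simpa using hq, by lia⟩

/-- The closed box with lower left cell `(a, b)` and side length `J`. -/
def box (J a b : ℤ) : Finset (Fin n) :=
  {q | a ≤ H.x q ∧ H.x q ≤ a + J ∧ b ≤ H.y q ∧ H.y q ≤ b + J}

/-- No strip of width one and length `J` contains more than `P` qubits. -/
def StripLE (J : ℤ) (P : ℕ) : Prop :=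
  (∀ a b, #{q | H.x q = a ∧ b ≤ H.y q ∧ H.y q ≤ b + J} ≤ P) ∧
    ∀ a b, #{q | H.y q = b ∧ a ≤ H.x q ∧ H.x q ≤ a + J} ≤ P

/-- The interior of a box is correctable, up to bad qubits, if the box contains few bad qubits and
its sides are short. -/
theorem correctable_interior {J : ℤ} {P : ℕ} (hP : H.StripLE J P) (a b : ℤ)
    (h : #(H.bad ∩ H.box J a b) + 5 * P < d) :
    Correctable H.S {q | q ∉ H.bad ∧ a < H.x q ∧ H.x q < a + J ∧ b < H.y q ∧ H.y q < b + J} := by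
  let V (j : ℤ) : Finset (Fin n) := {q | H.x q = j ∧ b ≤ H.y q ∧ H.y q ≤ b + J}
  let W (j : ℤ) : Finset (Fin n) := {q | H.y q = j ∧ a ≤ H.x q ∧ H.x q ≤ a + J}
  refine H.correctable_of_sweep _
    (fun j => H.bad ∩ H.box J a b ∪ V a ∪ V (a + J) ∪ V j ∪ W b ∪ W (b + J)) ?_ ?_ ?_
  · intro j
    have h1 := hP.1 a b
    have h2 := hP.1 (a + J) b
    have h3 := hP.1 j b
    have h4 := hP.2 a b
    have h5 := hP.2 a (b + J)
    have g1 := Finset.card_union_le (H.bad ∩ H.box J a b) (V a)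
    have g2 := Finset.card_union_le (H.bad ∩ H.box J a b ∪ V a) (V (a + J))
    have g3 := Finset.card_union_le (H.bad ∩ H.box J a b ∪ V a ∪ V (a + J)) (V j)
    have g4 := Finset.card_union_le (H.bad ∩ H.box J a b ∪ V a ∪ V (a + J) ∪ V j) (W b)
    have g5 := Finset.card_union_le (H.bad ∩ H.box J a b ∪ V a ∪ V (a + J) ∪ V j ∪ W b)
      (W (b + J))
    simp only [V, W] at *
    lia
  · intro q hq
    simp only [Finset.mem_filter, Finset.mem_univ, true_and] at hq
    have : q ∈ V (H.x q) := by simp [V]; lia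
    simp [this]
  · intro j i p hp hpj hpi q hqi
    simp only [Finset.mem_filter, Finset.mem_univ, true_and] at hp
    have h1 := abs_le.1 (H.local_x i p q hpi hqi hp.1)
    have h2 := abs_le.1 (H.local_y i p q hpi hqi hp.1)
    simp only [Finset.mem_union, Finset.mem_inter, box, V, W, Finset.mem_filter, Finset.mem_univ,
      true_and]
    by_cases hq : q ∈ H.bad <;> simp only [hq, not_true, not_false_iff] <;> lia

end LocalCode

/-! ### The grid of squares -/

/-- The integer `a` is within `w` of a multiple of `J`. -/
def NearMul (J w a : ℤ) : Prop := ∃ m : ℤ, |a - J * m| ≤ w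

theorem NearMul.of_abs_le {J v w a b : ℤ} (h : NearMul J v a) (hab : |a - b| ≤ w - v) :
    NearMul J w b := by
  obtain ⟨m, hm⟩ := h
  refine ⟨m, ?_⟩
  rw [abs_le] at *
  lia

theorem ediv_eq_of_not_nearMul {J a b : ℤ} (hJ : 0 < J) (ha : ¬ NearMul J 0 a)
    (hb : ¬ NearMul J 0 b) (hab : |a - b| ≤ 1) : a / J = b / J := by
  have h1 := Int.mul_ediv_add_emod a J
  have h2 := Int.mul_ediv_add_emod b J
  have h3 := Int.emod_nonneg a hJ.ne'
  have h4 := Int.emod_lt_of_pos a hJ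
  have h5 := Int.emod_nonneg b hJ.ne'
  have h6 := Int.emod_lt_of_pos b hJ
  have h7 : a % J ≠ 0 := fun h => ha ⟨a / J, by rw [abs_le]; lia⟩
  have h8 : b % J ≠ 0 := fun h => hb ⟨b / J, by rw [abs_le]; lia⟩
  rw [abs_le] at hab
  rcases lt_trichotomy (a / J) (b / J) with h | h | h
  · have := mul_le_mul_of_nonneg_left (Int.add_one_le_iff.2 h) hJ.le
    rw [mul_add] at this
    lia
  · exact h
  · have := mul_le_mul_of_nonneg_left (Int.add_one_le_iff.2 h) hJ.le
    rw [mul_add] at this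
    lia

theorem eq_of_nearMul_zero {J a b : ℤ} (hJ : 2 ≤ J) (ha : NearMul J 0 a) (hb : NearMul J 0 b)
    (hab : |a - b| ≤ 1) : a = b := by
  obtain ⟨l, hl⟩ := ha
  obtain ⟨m, hm⟩ := hb
  rw [abs_nonpos_iff, sub_eq_zero] at hl hm
  subst hl hm
  rw [← mul_sub, abs_mul, abs_of_pos (by lia)] at hab
  have : |l - m| = 0 := by
    by_contra h
    have h1 : 1 ≤ |l - m| := by have := abs_nonneg (l - m); lia
    nlinarith
  rw [abs_eq_zero, sub_eq_zero] at this
  rw [this]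

theorem lt_ediv_mul_of_not_nearMul {J a : ℤ} (hJ : 0 < J) (ha : ¬ NearMul J 0 a) :
    J * (a / J) < a ∧ a < J * (a / J) + J := by
  have h1 := Int.mul_ediv_add_emod a J
  have h3 := Int.emod_nonneg a hJ.ne'
  have h4 := Int.emod_lt_of_pos a hJ
  have h7 : a % J ≠ 0 := fun h => ha ⟨a / J, by rw [abs_le]; lia⟩
  lia

/-- Among `J` consecutive shifts of an integer, at most `2 w + 1` are within `w` of a multiple
of `J`. -/
theorem card_shift_nearMul_le {J : ℕ} (w : ℕ) (a : ℤ) [DecidablePred (NearMul J w)] :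
    #((Finset.range J).filter fun s : ℕ => NearMul J w (a - s)) ≤ 2 * w + 1 := by
  classical
  have hsub : (Finset.range J).filter (fun s : ℕ => NearMul J w (a - s)) ⊆
      (Finset.Icc (-w : ℤ) w).image fun e => ((a + e) % J).toNat := by
    intro s hs
    rw [Finset.mem_filter, Finset.mem_range] at hs
    obtain ⟨hs, m, hm⟩ := hs
    rw [abs_le] at hm
    refine Finset.mem_image.2 ⟨s - a + J * m, by rw [Finset.mem_Icc]; lia, ?_⟩
    rw [show a + (s - a + J * m) = s + J * m by ring, Int.add_mul_emod_self_left,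
      Int.emod_eq_of_lt (by lia) (by lia)]
    simp
  refine (Finset.card_le_card hsub).trans (Finset.card_image_le.trans ?_)
  rw [Int.card_Icc]
  lia

/-! ### Bounds on the number of logical qubits -/

namespace LocalCode
variable {n d : ℕ} (H : LocalCode n d)

open Classical in
/-- The edges of the squares of side length `J`, without their corners and bad qubits, are
correctable: they are decoupled short strips. -/
theorem correctable_edges {J : ℤ} (hJ : 2 ≤ J) {P : ℕ} (hP : H.StripLE J P) (hPd : P < d) :
    Correctable H.S {q | q ∉ H.bad ∧ ((NearMul J 0 (H.x q) ∧ ¬ NearMul J 0 (H.y q)) ∨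
      (NearMul J 0 (H.y q) ∧ ¬ NearMul J 1 (H.x q)))} := by
  refine correctable_of_pieces H.span_eq
    (fun q => if NearMul J 0 (H.x q) then (true, H.x q, H.y q / J) else (false, H.x q / J, H.y q))
    ?_ ?_
  · intro i p hp q hq hpi hqi
    simp only [Finset.mem_filter, Finset.mem_univ, true_and] at hp hq
    have hx := H.local_x i p q hpi hqi hp.1
    have hy := H.local_y i p q hpi hqi hp.1
    have hx' : |H.x q - H.x p| ≤ 1 := by rwa [abs_sub_comm]
    have h01 : ∀ a, NearMul J 0 a → NearMul J 1 a := fun a h => h.of_abs_le (by simp)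
    rcases hp.2 with ⟨h1, h2⟩ | ⟨h1, h2⟩ <;> rcases hq.2 with ⟨h3, h4⟩ | ⟨h3, h4⟩
    · simp only [h1, h3, if_true]
      rw [eq_of_nearMul_zero hJ h1 h3 hx, ediv_eq_of_not_nearMul (by lia) h2 h4 hy]
    · exact absurd (h1.of_abs_le (by simpa using hx)) h4
    · exact absurd (h3.of_abs_le (by simpa using hx')) h2
    · have h5 : ¬ NearMul J 0 (H.x p) := fun h => h2 (h01 _ h)
      have h6 : ¬ NearMul J 0 (H.x q) := fun h => h4 (h01 _ h)
      simp only [h5, h6, if_false]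
      rw [eq_of_nearMul_zero hJ h1 h3 hy, ediv_eq_of_not_nearMul (by lia) h5 h6 hx]
  · rintro ⟨t, a, b⟩
    have hem := fun z : ℤ => Int.mul_ediv_add_emod z J
    have hem0 := fun z : ℤ => Int.emod_nonneg z (show J ≠ 0 by lia)
    have hem1 := fun z : ℤ => Int.emod_lt_of_pos z (show 0 < J by lia)
    refine H.correctable_of_card_lt _ (lt_of_le_of_lt ?_ hPd)
    cases t
    · refine (Finset.card_le_card fun q hq => ?_).trans (hP.2 (J * a) b)
      simp only [Finset.mem_filter, Finset.mem_univ, true_and] at hq ⊢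
      have h1 := hq.2
      split_ifs at h1
      · simp at h1
      · simp only [Prod.mk.injEq, true_and] at h1
        have := hem (H.x q); have := hem0 (H.x q); have := hem1 (H.x q)
        rw [h1.1] at *
        lia
    · refine (Finset.card_le_card fun q hq => ?_).trans (hP.1 a (J * b))
      simp only [Finset.mem_filter, Finset.mem_univ, true_and] at hq ⊢
      have h1 := hq.2
      split_ifs at h1
      · simp only [Prod.mk.injEq, true_and] at h1
        have := hem (H.y q); have := hem0 (H.y q); have := hem1 (H.y q)
        rw [h1.2] at *
        lia
      · simp at h1

/-- The square of a qubit contains so many bad qubits that the sweeping argument fails there. -/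
def Heavy (J : ℤ) (P : ℕ) (q : Fin n) : Prop :=
  d ≤ #(H.bad ∩ H.box J (J * (H.x q / J)) (J * (H.y q / J))) + 5 * P

open Classical in
/-- The interiors of the squares of side length `J` that are not heavy are simultaneously
correctable, up to bad qubits. -/
theorem correctable_squares {J : ℤ} (hJ : 2 ≤ J) {P : ℕ} (hP : H.StripLE J P) (hd : 0 < d) :
    Correctable H.S {q | q ∉ H.bad ∧ ¬ NearMul J 0 (H.x q) ∧ ¬ NearMul J 0 (H.y q) ∧
      ¬ H.Heavy J P q} := by
  refine correctable_of_pieces H.span_eq (fun q => (H.x q / J, H.y q / J)) ?_ ?_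
  · intro i p hp q hq hpi hqi
    simp only [Finset.mem_filter, Finset.mem_univ, true_and] at hp hq
    rw [ediv_eq_of_not_nearMul (by lia) hp.2.1 hq.2.1 (H.local_x i p q hpi hqi hp.1),
      ediv_eq_of_not_nearMul (by lia) hp.2.2.1 hq.2.2.1 (H.local_y i p q hpi hqi hp.1)]
  · rintro ⟨a, b⟩
    by_cases hl : #(H.bad ∩ H.box J (J * a) (J * b)) + 5 * P < d
    · refine (H.correctable_interior hP _ _ hl).mono fun q hq => ?_
      simp only [Finset.mem_filter, Finset.mem_univ, true_and, Prod.mk.injEq] at hq ⊢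
      have h1 := lt_ediv_mul_of_not_nearMul (by lia) hq.1.2.1
      have h2 := lt_ediv_mul_of_not_nearMul (by lia) hq.1.2.2.1
      rw [hq.2.1] at h1
      rw [hq.2.2] at h2
      exact ⟨hq.1.1, h1.1, h1.2, h2.1, h2.2⟩
    · refine H.correctable_of_card_lt _ ?_
      rwa [Finset.filter_eq_empty_iff.2, Finset.card_empty]
      intro q hq hab
      simp only [Finset.mem_filter, Finset.mem_univ, true_and, Prod.mk.injEq] at hq hab
      refine hq.2.2.2 ?_
      rw [Heavy, hab.1, hab.2]
      lia

open Classical in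
/-- The qubits near the corners of the squares of side length `J`. -/
noncomputable def corners (J : ℤ) : Finset (Fin n) :=
  {q | NearMul J 1 (H.x q) ∧ NearMul J 0 (H.y q)}

open Classical in
/-- If the bad qubits are few compared to the number of logical qubits, they can be discarded
together with the corners and the heavy squares. -/
theorem le_of_heavy {k : ℕ} (hk : Module.finrank (ZMod 2) H.S + k = n) {J : ℤ} (hJ : 2 ≤ J)
    {P : ℕ} (hP : H.StripLE J P) (hPd : P < d) :
    k ≤ #(H.corners J) + #H.bad + #{q | H.Heavy J P q} := by
  have hA := H.correctable_squares hJ hP (by lia)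
  have hB := H.correctable_edges hJ hP hPd
  rw [← defectLE_zero_iff H.isotropic] at hA hB
  have h := DefectLE.le_card_add (e := 0) hk hA hB
    (C := H.corners J ∪ H.bad ∪ ({q | H.Heavy J P q} : Finset (Fin n))) ?_ ?_
  · have h1 := Finset.card_union_le (H.corners J ∪ H.bad)
      ({q | H.Heavy J P q} : Finset (Fin n))
    have h2 := Finset.card_union_le (H.corners J) H.bad
    lia
  · rw [Finset.disjoint_left]
    intro q hq hq'
    simp only [Finset.mem_filter, Finset.mem_univ, true_and] at hq hq'
    tauto
  · intro q
    simp only [Finset.mem_filter, Finset.mem_univ, true_and, Finset.mem_union, corners]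
    have h01 : NearMul J 0 (H.x q) → NearMul J 1 (H.x q) := fun h => h.of_abs_le (by simp)
    tauto

open Classical in
/-- If the bad qubits are few compared to the distance, only those near the edges of the squares
have to be discarded. The other bad qubits, `d` being larger than their number, are correctable.
They are decoupled from the rings of cells along the boundary of each square, so that the union `T`
of these rings and these bad qubits is correctable. It contains the outer boundary of the rest of
the squares, up to the discarded qubits, and the expansion lemma applies. -/
theorem le_of_card_bad {k : ℕ} (hk : Module.finrank (ZMod 2) H.S + k = n) {J : ℤ} (hJ : 2 ≤ J)
    {P : ℕ} (hP : H.StripLE J P) (hPd : #H.bad + 5 * P < d) :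
    k ≤ #(H.corners J) + #{q ∈ H.bad | NearMul J 2 (H.x q) ∨ NearMul J 2 (H.y q)} := by
  have hlight : ∀ q, ¬ H.Heavy J P q := fun q hq => by
    have := Finset.card_le_card
      (Finset.inter_subset_left (s₁ := H.bad) (s₂ := H.box J (J * (H.x q / J)) (J * (H.y q / J))))
    rw [Heavy] at hq
    lia
  have hB := H.correctable_edges hJ hP (by lia)
  let U : Finset (Fin n) := {q | q ∉ H.bad ∧ ¬ NearMul J 1 (H.x q) ∧ ¬ NearMul J 1 (H.y q)}
  let T : Finset (Fin n) := {q | (q ∈ H.bad ∧ ¬ NearMul J 2 (H.x q) ∧ ¬ NearMul J 2 (H.y q)) ∨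
    (q ∉ H.bad ∧ ¬ NearMul J 0 (H.x q) ∧ ¬ NearMul J 0 (H.y q) ∧
      (NearMul J 1 (H.x q) ∨ NearMul J 1 (H.y q)))}
  let N : Finset (Fin n) := {q ∈ H.bad | NearMul J 2 (H.x q) ∨ NearMul J 2 (H.y q)}
  have h01 : ∀ a, NearMul J 0 a → NearMul J 1 a := fun a h => h.of_abs_le (by simp)
  have hU : Correctable H.S U := (H.correctable_squares hJ hP (by lia)).mono fun q hq => by
    simp only [U, Finset.mem_filter, Finset.mem_univ, true_and] at hq ⊢
    exact ⟨hq.1, fun h => hq.2.1 (h01 _ h), fun h => hq.2.2 (h01 _ h), hlight q⟩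
  have hT : Correctable H.S T := by
    refine correctable_of_pieces H.span_eq
      (fun q => if q ∈ H.bad then none else some (H.x q / J, H.y q / J)) ?_ ?_
    · have hmix : ∀ i, ∀ p ∈ T, ∀ q ∈ T, H.Γ i p ≠ 0 → H.Γ i q ≠ 0 → p ∉ H.bad →
          q ∉ H.bad := by
        intro i p hp q hq hpi hqi hpb hqb
        simp only [T, Finset.mem_filter, Finset.mem_univ, true_and, hpb, hqb, false_and,
          not_true, not_false_iff, or_false, false_or] at hp hq
        rcases hp.2.2 with h | h
        · exact hq.1 (h.of_abs_le (H.local_x i p q hpi hqi hpb))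
        · exact hq.2 (h.of_abs_le (H.local_y i p q hpi hqi hpb))
      intro i p hp q hq hpi hqi
      by_cases hpb : p ∈ H.bad
      · have hqb : q ∈ H.bad := by_contra fun h => hmix i q hq p hp hqi hpi h hpb
        simp [hpb, hqb]
      · have hqb := hmix i p hp q hq hpi hqi hpb
        simp only [T, Finset.mem_filter, Finset.mem_univ, true_and, hpb, hqb, false_and,
          not_false_iff, false_or] at hp hq
        simp only [hpb, hqb, if_false]
        rw [ediv_eq_of_not_nearMul (by lia) hp.1 hq.1 (H.local_x i p q hpi hqi hpb),
          ediv_eq_of_not_nearMul (by lia) hp.2.1 hq.2.1 (H.local_y i p q hpi hqi hpb)]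
    · rintro (_ | ⟨a, b⟩)
      · refine H.correctable_of_card_lt _ (lt_of_le_of_lt (Finset.card_le_card ?_)
          (show #H.bad < d by lia))
        intro q hq
        by_contra hqb
        simp [hqb] at hq
      · -- The ring around a square consists of four strips.
        let V (j : ℤ) : Finset (Fin n) :=
          {q | H.x q = j ∧ J * b ≤ H.y q ∧ H.y q ≤ J * b + J}
        let W (j : ℤ) : Finset (Fin n) :=
          {q | H.y q = j ∧ J * a ≤ H.x q ∧ H.x q ≤ J * a + J}
        refine H.correctable_of_card_lt _ (lt_of_le_of_lt (Finset.card_le_card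
          (t := V (J * a + 1) ∪ V (J * a + J - 1) ∪ W (J * b + 1) ∪ W (J * b + J - 1)) ?_) ?_)
        · intro q hq
          simp only [T, Finset.mem_filter, Finset.mem_univ, true_and] at hq
          obtain ⟨h1, h2⟩ := hq
          split_ifs at h2 with hqb
          simp only [hqb, false_and, not_false_iff, true_and, false_or] at h1
          simp only [Option.some.injEq, Prod.mk.injEq] at h2
          have h3 := lt_ediv_mul_of_not_nearMul (by lia) h1.1
          have h4 := lt_ediv_mul_of_not_nearMul (by lia) h1.2.1
          rw [h2.1] at h3
          rw [h2.2] at h4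
          have key : ∀ c z : ℤ, J * c < z → z < J * c + J → NearMul J 1 z →
              z = J * c + 1 ∨ z = J * c + J - 1 := by
            rintro c z hz1 hz2 ⟨m, hm⟩
            rw [abs_le] at hm
            rcases lt_trichotomy m c with h | h | h
            · have := mul_le_mul_of_nonneg_left (Int.add_one_le_iff.2 h) (show 0 ≤ J by lia)
              rw [mul_add] at this
              lia
            · subst h; lia
            · have := mul_le_mul_of_nonneg_left (Int.add_one_le_iff.2 h) (show 0 ≤ J by lia)
              rw [mul_add] at this
              lia
          simp only [V, W, Finset.mem_union, Finset.mem_filter, Finset.mem_univ, true_and]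
          rcases h1.2.2 with h | h
          · rcases key a _ h3.1 h3.2 h with h | h <;> simp only [h] <;> lia
          · rcases key b _ h4.1 h4.2 h with h | h <;> simp only [h] <;> lia
        · have g1 := Finset.card_union_le (V (J * a + 1)) (V (J * a + J - 1))
          have g2 := Finset.card_union_le (V (J * a + 1) ∪ V (J * a + J - 1)) (W (J * b + 1))
          have g3 := Finset.card_union_le (V (J * a + 1) ∪ V (J * a + J - 1) ∪ W (J * b + 1))
            (W (J * b + J - 1))
          have h1 := hP.1 (J * a + 1) (J * b)
          have h2 := hP.1 (J * a + J - 1) (J * b)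
          have h3 := hP.2 (J * a) (J * b + 1)
          have h4 := hP.2 (J * a) (J * b + J - 1)
          simp only [V, W] at *
          lia
  have hTN : DefectLE H.S (T ∪ N) (2 * #N) := by
    simpa using ((defectLE_zero_iff H.isotropic).2 hT).union_card N
  have hA : DefectLE H.S (U ∪ (T ∪ N)) (2 * #N) := by
    refine hTN.union_correctable H.span_eq H.isotropic hU fun i p hp hpi q hqi => ?_
    simp only [U, Finset.mem_filter, Finset.mem_univ, true_and] at hp
    have hx : ¬ NearMul J 0 (H.x q) := fun h =>
      hp.2.1 (h.of_abs_le (by rw [abs_sub_comm]; exact H.local_x i p q hpi hqi hp.1))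
    have hy : ¬ NearMul J 0 (H.y q) := fun h =>
      hp.2.2 (h.of_abs_le (by rw [abs_sub_comm]; exact H.local_y i p q hpi hqi hp.1))
    simp only [U, T, N, Finset.mem_union, Finset.mem_filter, Finset.mem_univ, true_and]
    tauto
  refine hA.le_card_add hk ((defectLE_zero_iff H.isotropic).2 hB) ?_ ?_
  · rw [Finset.disjoint_left]
    intro q hq hq'
    simp only [U, T, N, Finset.mem_union, Finset.mem_filter, Finset.mem_univ, true_and] at hq hq'
    have := h01 (H.x q)
    have := h01 (H.y q)
    tauto
  · intro q
    simp only [U, T, N, Finset.mem_union, Finset.mem_filter, Finset.mem_univ, true_and, corners]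
    by_cases hq : q ∈ H.bad
    · by_cases h : NearMul J 2 (H.x q) ∨ NearMul J 2 (H.y q)
      · exact Or.inl (Or.inr (Or.inr ⟨hq, h⟩))
      · exact Or.inl (Or.inr (Or.inl (Or.inl ⟨hq, not_or.1 h⟩)))
    · by_cases hx : NearMul J 0 (H.x q) <;> by_cases hy : NearMul J 0 (H.y q)
      · exact Or.inr (Or.inr ⟨h01 _ hx, hy⟩)
      · exact Or.inr (Or.inl ⟨hq, Or.inl ⟨hx, hy⟩⟩)
      · by_cases hx1 : NearMul J 1 (H.x q)
        · exact Or.inr (Or.inr ⟨hx1, hy⟩)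
        · exact Or.inr (Or.inl ⟨hq, Or.inr ⟨hy, hx1⟩⟩)
      · by_cases h : NearMul J 1 (H.x q) ∨ NearMul J 1 (H.y q)
        · exact Or.inl (Or.inr (Or.inl (Or.inr ⟨hq, hx, hy, h⟩)))
        · exact Or.inl (Or.inl ⟨hq, not_or.1 h⟩)

/-- Move the origin of the grid. -/
def shift (s t : ℤ) : LocalCode n d where
  __ := H
  x := fun q => H.x q - s
  y := fun q => H.y q - t
  local_x := fun i p q hp hq hb => by simpa using H.local_x i p q hp hq hb
  local_y := fun i p q hp hq hb => by simpa using H.local_y i p q hp hq hb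

theorem StripLE.shift {H : LocalCode n d} {J : ℤ} {P : ℕ} (h : H.StripLE J P) (s t : ℤ) :
    (H.shift s t).StripLE J P := by
  refine ⟨fun a b => (Finset.card_le_card fun q hq => ?_).trans (h.1 (a + s) (b + t)),
    fun a b => (Finset.card_le_card fun q hq => ?_).trans (h.2 (a + s) (b + t))⟩
  all_goals
    have hq := (Finset.mem_filter.1 hq).2
    simp only [LocalCode.shift] at hq
    refine Finset.mem_filter.2 ⟨Finset.mem_univ _, ?_⟩
    lia

open Classical in
/-- A random shift leaves few qubits near the corners. -/
theorem sum_card_corners_le (J : ℕ) :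
    ∑ s ∈ Finset.range J, ∑ t ∈ Finset.range J, #((H.shift s t).corners J) ≤ 3 * n := by
  have h : ∀ q : Fin n, ∑ s ∈ Finset.range J, ∑ t ∈ Finset.range J,
      (if NearMul J 1 (H.x q - s) ∧ NearMul J 0 (H.y q - t) then 1 else 0) ≤ 3 := by
    intro q
    have h1 := card_shift_nearMul_le (J := J) 1 (H.x q)
    have h0 := card_shift_nearMul_le (J := J) 0 (H.y q)
    rw [Finset.card_filter] at h1 h0
    calc _ = (∑ s ∈ Finset.range J, if NearMul J 1 (H.x q - s) then 1 else 0) *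
          ∑ t ∈ Finset.range J, if NearMul J 0 (H.y q - t) then 1 else 0 := by
          rw [Finset.sum_mul_sum]
          refine Finset.sum_congr rfl fun s _ => Finset.sum_congr rfl fun t _ => ?_
          split_ifs <;> simp_all
      _ ≤ (2 * 1 + 1) * (2 * 0 + 1) := by
          refine Nat.mul_le_mul ?_ ?_
          · exact_mod_cast h1
          · exact_mod_cast h0
      _ = 3 := rfl
  have hc : ∀ s t : ℕ, #((H.shift s t).corners J) =
      ∑ q : Fin n, if NearMul J 1 (H.x q - s) ∧ NearMul J 0 (H.y q - t) then 1 else 0 :=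
    fun s t => Finset.card_filter _ _
  calc _ = ∑ q : Fin n, ∑ s ∈ Finset.range J, ∑ t ∈ Finset.range J,
      (if NearMul J 1 (H.x q - s) ∧ NearMul J 0 (H.y q - t) then 1 else 0) := by
        simp_rw [hc]
        rw [Finset.sum_comm (s := Finset.univ)]
        exact Finset.sum_congr rfl fun s _ => Finset.sum_comm
    _ ≤ ∑ q : Fin n, 3 := Finset.sum_le_sum fun q _ => h q
    _ = 3 * n := by simp [mul_comm]

open Classical in
/-- A random shift leaves few bad qubits near the edges. -/
theorem sum_card_near_edges_le (J : ℕ) :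
    ∑ s ∈ Finset.range J, ∑ t ∈ Finset.range J,
      #{q ∈ H.bad | NearMul J 2 (H.x q - s) ∨ NearMul J 2 (H.y q - t)} ≤
        10 * J * #H.bad := by
  have h : ∀ q : Fin n, ∑ s ∈ Finset.range J, ∑ t ∈ Finset.range J,
      (if NearMul J 2 (H.x q - s) ∨ NearMul J 2 (H.y q - t) then 1 else 0) ≤ 10 * J := by
    intro q
    have h1 := card_shift_nearMul_le (J := J) 2 (H.x q)
    have h2 := card_shift_nearMul_le (J := J) 2 (H.y q)
    rw [Finset.card_filter] at h1 h2
    calc _ ≤ ∑ s ∈ Finset.range J, ∑ t ∈ Finset.range J,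
          ((if NearMul J 2 (H.x q - s) then 1 else 0) +
            if NearMul J 2 (H.y q - t) then 1 else 0) := by
          refine Finset.sum_le_sum fun s _ => Finset.sum_le_sum fun t _ => ?_
          split_ifs <;> simp_all
      _ = J * (∑ s ∈ Finset.range J, if NearMul J 2 (H.x q - s) then 1 else 0) +
          J * ∑ t ∈ Finset.range J, if NearMul J 2 (H.y q - t) then 1 else 0 := by
          simp only [Finset.sum_add_distrib, Finset.sum_const, Finset.card_range, smul_eq_mul,
            Finset.mul_sum]
      _ ≤ J * (2 * 2 + 1) + J * (2 * 2 + 1) := by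
          refine Nat.add_le_add (Nat.mul_le_mul_left _ ?_) (Nat.mul_le_mul_left _ ?_)
          · exact_mod_cast h1
          · exact_mod_cast h2
      _ = 10 * J := by ring
  calc _ = ∑ q ∈ H.bad, ∑ s ∈ Finset.range J, ∑ t ∈ Finset.range J,
      (if NearMul J 2 (H.x q - s) ∨ NearMul J 2 (H.y q - t) then 1 else 0) := by
        simp_rw [Finset.card_filter]
        rw [Finset.sum_comm (s := H.bad)]
        exact Finset.sum_congr rfl fun s _ => Finset.sum_comm
    _ ≤ ∑ q ∈ H.bad, 10 * J := Finset.sum_le_sum fun q _ => h q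
    _ = 10 * J * #H.bad := by simp [mul_comm]

/-- The average of `le_of_card_bad` over all positions of the grid. -/
theorem mul_sq_le_of_card_bad {k : ℕ} (hk : Module.finrank (ZMod 2) H.S + k = n) {J : ℕ}
    (hJ : 2 ≤ J) {P : ℕ} (hP : H.StripLE J P) (hPd : #H.bad + 5 * P < d) :
    k * J ^ 2 ≤ 3 * n + 10 * J * #H.bad := by
  classical
  have h1 := H.sum_card_corners_le J
  have h2 := H.sum_card_near_edges_le J
  calc k * J ^ 2 = ∑ s ∈ Finset.range J, ∑ t ∈ Finset.range J, k := by simp; ring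
    _ ≤ ∑ s ∈ Finset.range J, ∑ t ∈ Finset.range J, (#((H.shift s t).corners J) +
        #{q ∈ H.bad | NearMul J 2 (H.x q - s) ∨ NearMul J 2 (H.y q - t)}) :=
      Finset.sum_le_sum fun s _ => Finset.sum_le_sum fun t _ =>
        (H.shift s t).le_of_card_bad hk (by exact_mod_cast hJ) (hP.shift s t) hPd
    _ ≤ _ := by
      simp only [Finset.sum_add_distrib]
      exact Nat.add_le_add h1 h2

open Classical in
/-- The average of `le_of_heavy` over all positions of the grid. -/
theorem mul_sq_le_of_heavy {k : ℕ} (hk : Module.finrank (ZMod 2) H.S + k = n) {J : ℕ}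
    (hJ : 2 ≤ J) {P : ℕ} (hP : H.StripLE J P) (hPd : P < d) {h : ℕ}
    (hh : ∀ s t : ℤ, #{q | (H.shift s t).Heavy J P q} ≤ h) :
    k * J ^ 2 ≤ 3 * n + (#H.bad + h) * J ^ 2 := by
  have h1 := H.sum_card_corners_le J
  calc k * J ^ 2 = ∑ s ∈ Finset.range J, ∑ t ∈ Finset.range J, k := by simp; ring
    _ ≤ ∑ s ∈ Finset.range J, ∑ t ∈ Finset.range J, (#((H.shift s t).corners J) +
        (#H.bad + h)) :=
      Finset.sum_le_sum fun s _ => Finset.sum_le_sum fun t _ => by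
        have h2 := (H.shift s t).le_of_heavy hk (by exact_mod_cast hJ) (hP.shift s t) hPd
        have h3 := hh s t
        have h4 : #(H.shift s t).bad = #H.bad := rfl
        lia
    _ ≤ _ := by
      simp only [Finset.sum_add_distrib]
      refine Nat.add_le_add h1 (le_of_eq ?_)
      simp
      ring

end LocalCode

/-! ### Counting points and generators in boxes -/

/-- Points of a box of size `s × t` fall into at most `(s / σ + 2) (t / σ + 2)` cells of side
length `σ`. -/
theorem card_le_of_card_cell_le {α : Type*} (F : Finset α) (f g : α → ℝ) {σ : ℝ} (hσ : 0 < σ)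
    {m : ℕ} (hm : ∀ u v : ℤ, #{z ∈ F | ⌊f z / σ⌋ = u ∧ ⌊g z / σ⌋ = v} ≤ m) {a b s t : ℝ}
    (hs : 0 ≤ s) (ht : 0 ≤ t) (hf : ∀ z ∈ F, a ≤ f z ∧ f z ≤ a + s)
    (hg : ∀ z ∈ F, b ≤ g z ∧ g z ≤ b + t) :
    (#F : ℝ) ≤ m * ((s / σ + 2) * (t / σ + 2)) := by
  have hcard : ∀ a s : ℝ, 0 ≤ s → (#(Finset.Icc ⌊a / σ⌋ ⌊(a + s) / σ⌋) : ℝ) ≤ s / σ + 2 := by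
    intro a s hs
    have h1 : ⌊a / σ⌋ ≤ ⌊(a + s) / σ⌋ := Int.floor_le_floor (by gcongr; linarith)
    have h2 : (#(Finset.Icc ⌊a / σ⌋ ⌊(a + s) / σ⌋) : ℤ) = ⌊(a + s) / σ⌋ + 1 - ⌊a / σ⌋ := by
      rw [Int.card_Icc]; lia
    have h3 : (#(Finset.Icc ⌊a / σ⌋ ⌊(a + s) / σ⌋) : ℝ) = ⌊(a + s) / σ⌋ + 1 - ⌊a / σ⌋ := by
      exact_mod_cast h2
    have h4 := Int.floor_le ((a + s) / σ)
    have h5 := Int.lt_floor_add_one (a / σ)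
    have h6 := add_div a s σ
    linarith
  have h1 : #F ≤ m * #(Finset.Icc ⌊a / σ⌋ ⌊(a + s) / σ⌋ ×ˢ
      Finset.Icc ⌊b / σ⌋ ⌊(b + t) / σ⌋) := by
    refine Finset.card_le_mul_card_image_of_maps_to (f := fun z => (⌊f z / σ⌋, ⌊g z / σ⌋)) ?_ m ?_
    · intro z hz
      simp only [Finset.mem_product, Finset.mem_Icc]
      refine ⟨⟨?_, ?_⟩, ?_, ?_⟩ <;> refine Int.floor_le_floor ?_ <;> gcongr
      exacts [(hf z hz).1, (hf z hz).2, (hg z hz).1, (hg z hz).2]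
    · rintro ⟨u, v⟩ -
      simpa using hm u v
  calc (#F : ℝ) ≤ m * (#(Finset.Icc ⌊a / σ⌋ ⌊(a + s) / σ⌋) *
        #(Finset.Icc ⌊b / σ⌋ ⌊(b + t) / σ⌋)) := by
        rw [Finset.card_product] at h1; exact_mod_cast h1
    _ ≤ m * ((s / σ + 2) * (t / σ + 2)) := by
        have := hcard a s hs
        have := hcard b t ht
        gcongr

theorem abs_sub_lt_of_floor_div_eq {x y σ : ℝ} (hσ : 0 < σ) (h : ⌊x / σ⌋ = ⌊y / σ⌋) :
    |x - y| < σ := by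
  have := Int.abs_sub_lt_one_of_floor_eq_floor h
  rwa [← sub_div, abs_div, abs_of_pos hσ, div_lt_one hσ] at this

theorem floor_div_sub_le_one {x y σ : ℝ} (hσ : 0 < σ) (h : |x - y| ≤ σ) :
    |⌊x / σ⌋ - ⌊y / σ⌋| ≤ 1 := by
  have key : ∀ x y : ℝ, |x - y| ≤ σ → ⌊x / σ⌋ ≤ ⌊y / σ⌋ + 1 := by
    intro x y h
    rw [← Int.floor_add_one, ← div_self hσ.ne', ← add_div]
    have := (abs_le.1 h).2
    exact Int.floor_le_floor (by gcongr; linarith)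
  have h1 := key x y h
  have h2 := key y x (by rwa [abs_sub_comm])
  rw [abs_le]
  lia

/-- If the number of elements in layer `i` decays like `4 ^ (-i)` and only layers at scale at least
`y` occur, then the number of elements is dominated by the lowest of these layers. -/
theorem card_le_of_card_layer_le {α : Type*} (G : Finset α) (layer : α → ℕ) {c y : ℝ}
    (hc : 0 ≤ c) (hy : 0 < y) (hG : ∀ i, (#{g ∈ G | layer g = i} : ℝ) ≤ c / 4 ^ i)
    (hl : ∀ g ∈ G, y ≤ 2 ^ layer g) : (#G : ℝ) ≤ 4 / 3 * c / y ^ 2 := by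
  rcases G.eq_empty_or_nonempty with rfl | hne
  · simp; positivity
  obtain ⟨g₀, hg₀, hmin⟩ := G.exists_min_image layer hne
  obtain ⟨M, hM⟩ : ∃ M, ∀ g ∈ G, layer g < M :=
    ⟨G.sup layer + 1, fun g hg => Nat.lt_succ_of_le (Finset.le_sup hg)⟩
  calc (#G : ℝ) = ∑ i ∈ Finset.Ico (layer g₀) M, (#{g ∈ G | layer g = i} : ℝ) := by
        rw [← Nat.cast_sum, ← Finset.card_eq_sum_card_fiberwise]
        exact fun g hg => by simpa using ⟨hmin g hg, hM g hg⟩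
    _ ≤ ∑ i ∈ Finset.Ico (layer g₀) M, c * (1 / 4) ^ i := by
        refine Finset.sum_le_sum fun i _ => (hG i).trans_eq ?_
        rw [one_div, inv_pow]; rfl
    _ ≤ c * ((1 / 4) ^ layer g₀ / (1 - 1 / 4)) := by
        rw [← Finset.mul_sum]
        gcongr
        exact geom_sum_Ico_le_of_lt_one (by norm_num) (by norm_num)
    _ = 4 / 3 * c / (2 ^ layer g₀) ^ 2 := by
        have h4 : ((2 : ℝ) ^ layer g₀) ^ 2 = 4 ^ layer g₀ := by
          rw [← pow_mul, mul_comm, pow_mul]; norm_num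
        rw [h4, one_div_pow]
        ring
    _ ≤ 4 / 3 * c / y ^ 2 := by
        have := hl g₀ hg₀
        gcongr

namespace StackedImplementation
variable {A r : ℝ} {w b n : ℕ} {𝒞 : StabilizerCode n} (I : StackedImplementation A r w b 𝒞)

/-- The support of a generator. -/
noncomputable def supp (g : Fin I.numGen) : Finset (Fin n) :=
  (Set.toFinite (pauliSupport (I.gen g))).toFinset

theorem mem_supp {g : Fin I.numGen} {q : Fin n} : q ∈ I.supp g ↔ q ∈ pauliSupport (I.gen g) := by
  simp [supp]

theorem card_supp_le (g : Fin I.numGen) : #(I.supp g) ≤ w := by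
  rw [supp, ← Set.ncard_eq_toFinset_card]
  exact I.weight_le g

theorem abs_coord_sub_le (p q : Fin n) (j : Fin 2) :
    |I.pos p j - I.pos q j| ≤ dist (I.pos p) (I.pos q) := by
  rw [dist_eq_norm]
  simpa using PiLp.norm_apply_le (I.pos p - I.pos q) j

open Classical in
/-- A box of size `s × t` contains at most `(2 s + 2) (2 t + 2)` qubits. -/
theorem card_qubits_le {a c s t : ℝ} (hs : 0 ≤ s) (ht : 0 ≤ t) (F : Finset (Fin n))
    (hF : ∀ q ∈ F, (a ≤ I.pos q 0 ∧ I.pos q 0 ≤ a + s) ∧ c ≤ I.pos q 1 ∧ I.pos q 1 ≤ c + t) :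
    (#F : ℝ) ≤ (2 * s + 2) * (2 * t + 2) := by
  refine (card_le_of_card_cell_le F (fun q => I.pos q 0) (fun q => I.pos q 1)
    (σ := 1 / 2) (by norm_num) (m := 1) (fun u v => ?_) hs ht (fun q hq => (hF q hq).1)
    fun q hq => (hF q hq).2).trans_eq (by push_cast; ring)
  rw [Finset.card_le_one]
  intro p hp q hq
  rw [Finset.mem_filter] at hp hq
  by_contra hpq
  have h0 := abs_sub_lt_of_floor_div_eq (by norm_num) (hp.2.1.trans hq.2.1.symm)
  have h1 := abs_sub_lt_of_floor_div_eq (by norm_num) (hp.2.2.trans hq.2.2.symm)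
  have h2 := I.one_le_dist p q hpq
  rw [EuclideanSpace.dist_eq, Real.one_le_sqrt, Fin.sum_univ_two, Real.dist_eq, Real.dist_eq]
    at h2
  nlinarith [abs_nonneg (I.pos p 0 - I.pos q 0), abs_nonneg (I.pos p 1 - I.pos q 1)]

open Classical in
/-- The number of generators of layer `i` that touch a square of side length `s`. -/
theorem card_layer_touching_le (hr : 0 < r) (i : ℕ) {a c s : ℝ} (hs : 0 ≤ s)
    (F : Finset (Fin I.numGen)) (hFi : ∀ g ∈ F, I.layer g = i)
    (hF : ∀ g ∈ F, ∃ q ∈ I.supp g, (a ≤ I.pos q 0 ∧ I.pos q 0 ≤ a + s) ∧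
      c ≤ I.pos q 1 ∧ I.pos q 1 ≤ c + s) :
    (#F : ℝ) ≤ b * (2 * s / (r * 2 ^ i) + 6) ^ 2 := by
  set ρ : ℝ := r * 2 ^ i with hρ
  have hρ0 : 0 < ρ := by positivity
  have hcell := card_le_of_card_cell_le F (fun g => I.center g 0) (fun g => I.center g 1)
    (σ := ρ / 2) (by positivity) (m := b) (a := a - ρ) (b := c - ρ) (s := s + 2 * ρ)
    (t := s + 2 * ρ) ?_ (by positivity) (by positivity) ?_ ?_
  · refine hcell.trans_eq ?_
    have : (s + 2 * ρ) / (ρ / 2) + 2 = 2 * s / ρ + 6 := by field_simp; ring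
    rw [this, sq]
  · -- All balls of one cell contain the lower left corner of the cell.
    intro u v
    let z : EuclideanSpace ℝ (Fin 2) := !₂[u * (ρ / 2), v * (ρ / 2)]
    refine le_trans ?_ (I.overlap_le i z)
    rw [← Set.ncard_coe_finset]
    refine Set.ncard_le_ncard ?_
    intro g hg
    rw [Finset.mem_coe, Finset.mem_filter] at hg
    refine ⟨hFi g hg.1, ?_⟩
    have key : ∀ (x : ℝ) (u : ℤ), ⌊x / (ρ / 2)⌋ = u → |u * (ρ / 2) - x| ≤ ρ / 2 := by
      intro x u h
      rw [Int.floor_eq_iff, le_div_iff₀ (by positivity), div_lt_iff₀ (by positivity)] at h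
      rw [abs_le]
      constructor <;> linarith
    have h0 := key _ _ hg.2.1
    have h1 := key _ _ hg.2.2
    rw [Metric.mem_closedBall, EuclideanSpace.dist_eq, Real.sqrt_le_left hρ0.le,
      Fin.sum_univ_two, Real.dist_eq, Real.dist_eq]
    simp only [z, Matrix.cons_val_zero, Matrix.cons_val_one]
    nlinarith [abs_nonneg (u * (ρ / 2) - I.center g 0), abs_nonneg (v * (ρ / 2) - I.center g 1)]
  all_goals
    intro g hg
    obtain ⟨q, hq, h0, h1⟩ := hF g hg
    have h2 := I.support_subset g q (I.mem_supp.1 hq)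
    rw [Metric.mem_closedBall, hFi g hg, ← hρ, dist_eq_norm] at h2
    have h3 := fun j => abs_le.1 ((PiLp.norm_apply_le (I.pos q - I.center g) j).trans h2)
    simp only [PiLp.sub_apply] at h3
    have := h3 0
    have := h3 1
    constructor <;> linarith

open Classical in
/-- The generators of nonempty support whose ball has diameter at least `L`. -/
noncomputable def longGens (L : ℝ) : Finset (Fin I.numGen) :=
  {g | (I.supp g).Nonempty ∧ L ≤ 2 * (r * 2 ^ I.layer g)}

theorem mem_longGens {L : ℝ} {g : Fin I.numGen} :
    g ∈ I.longGens L ↔ (I.supp g).Nonempty ∧ L ≤ 2 * (r * 2 ^ I.layer g) := by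
  simp [longGens]

/-- The constant in the bound on the number of long generators. -/
noncomputable def genConst (A r : ℝ) (b : ℕ) : ℝ :=
  16 / 3 * r ^ 2 * (b * ((2 / r + 6) ^ 2 * A ^ 2))

/-- The layered structure leaves only few long generators: at most `O(n / 4 ^ i)` balls of layer
`i` fit into the square with bounded overlap, since that layer is at most as coarse as the
square. -/
theorem card_longGens_le (hr : 0 < r) {L : ℝ} (hL : 0 < L) :
    (#(I.longGens L) : ℝ) ≤ genConst A r b * n / L ^ 2 := by
  classical
  refine (card_le_of_card_layer_le (I.longGens L) I.layer
    (c := b * ((2 / r + 6) ^ 2 * A ^ 2) * n) (y := L / (2 * r)) (by positivity) (by positivity)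
    (fun i => ?_) (fun g hg => ?_)).trans_eq ?_
  · by_cases hi : ∃ g, I.layer g = i
    · obtain ⟨g₀, rfl⟩ := hi
      set i := I.layer g₀
      have hle := I.layer_le g₀
      have hAn : 0 ≤ A * √n := (by positivity : (0 : ℝ) ≤ 2 ^ i).trans hle
      refine (I.card_layer_touching_le hr i (a := I.corner 0) (c := I.corner 1)
        (s := A * √n) hAn _ (fun g hg => (Finset.mem_filter.1 hg).2) (fun g hg => ?_)).trans ?_
      · obtain ⟨q, hq⟩ := (I.mem_longGens.1 (Finset.mem_filter.1 hg).1).1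
        exact ⟨q, hq, I.pos_mem q 0, I.pos_mem q 1⟩
      · have h1 : 2 * (A * √n) / (r * 2 ^ i) + 6 ≤ (2 / r + 6) * (A * √n / 2 ^ i) := by
          have : 1 ≤ A * √n / 2 ^ i := by rwa [one_le_div (by positivity)]
          have e : 2 * (A * √n) / (r * 2 ^ i) = 2 / r * (A * √n / 2 ^ i) := by field_simp
          rw [e, add_mul]
          linarith
        calc (b : ℝ) * (2 * (A * √n) / (r * 2 ^ i) + 6) ^ 2
            ≤ b * ((2 / r + 6) * (A * √n / 2 ^ i)) ^ 2 := by gcongr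
          _ = b * ((2 / r + 6) ^ 2 * A ^ 2) * n / 4 ^ i := by
            have h4 : (4 : ℝ) ^ i = 2 ^ i * 2 ^ i := by rw [← mul_pow]; norm_num
            have hn : √(n : ℝ) * √n = n := Real.mul_self_sqrt (by positivity)
            rw [h4]
            calc _ = b * ((2 / r + 6) ^ 2 * A ^ 2) * (√(n : ℝ) * √n) / (2 ^ i * 2 ^ i) := by ring
              _ = _ := by rw [hn]
    · rw [Finset.filter_eq_empty_iff.2 fun g _ h => hi ⟨g, h⟩]
      simp only [Finset.card_empty, Nat.cast_zero]
      positivity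
  · rw [div_le_iff₀ (by positivity)]
    have := (I.mem_longGens.1 hg).2
    linarith
  · rw [genConst]
    field_simp
    ring

/-- The number of interactions of length at least `ℓ`. -/
theorem card_interactions_le (hr : 0 < r) {ℓ : ℝ} (hℓ : 0 < ℓ) :
    ((I.interactions ℓ).ncard : ℝ) ≤ w ^ 2 * genConst A r b * (n / ℓ ^ 2) := by
  classical
  have h1 : I.interactions ℓ ⊆ ((I.longGens ℓ).biUnion fun g => I.supp g ×ˢ I.supp g :
      Finset (Fin n × Fin n)) := by
    rintro ⟨p, q⟩ ⟨-, ⟨g, hp, hq⟩, hl⟩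
    simp only [Finset.coe_biUnion, Set.mem_iUnion, Finset.mem_coe, Finset.mem_product]
    refine ⟨g, I.mem_longGens.2 ⟨⟨p, I.mem_supp.2 hp⟩, ?_⟩, I.mem_supp.2 hp, I.mem_supp.2 hq⟩
    have h2 := dist_triangle_right (I.pos p) (I.pos q) (I.center g)
    have h3 := Metric.mem_closedBall.1 (I.support_subset g p hp)
    have h4 := Metric.mem_closedBall.1 (I.support_subset g q hq)
    linarith
  have h2 : (I.interactions ℓ).ncard ≤ #(I.longGens ℓ) * (w * w) := by
    refine (Set.ncard_le_ncard h1 (Finset.finite_toSet _)).trans ?_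
    rw [Set.ncard_coe_finset]
    refine Finset.card_biUnion_le_card_mul _ _ _ fun g _ => ?_
    rw [Finset.card_product]
    exact Nat.mul_le_mul (I.card_supp_le g) (I.card_supp_le g)
  calc ((I.interactions ℓ).ncard : ℝ) ≤ #(I.longGens ℓ) * (w * w) := by exact_mod_cast h2
    _ ≤ genConst A r b * n / ℓ ^ 2 * (w * w) := by
      have := I.card_longGens_le hr hℓ
      gcongr
    _ = _ := by ring

open Classical in
/-- The qubits touched by long generators. -/
noncomputable def longQubits (L : ℝ) : Finset (Fin n) := (I.longGens L).biUnion I.supp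

theorem mem_longQubits {L : ℝ} {q : Fin n} :
    q ∈ I.longQubits L ↔ ∃ g ∈ I.longGens L, q ∈ I.supp g := by
  simp [longQubits]

theorem card_longQubits_le (hr : 0 < r) {L : ℝ} (hL : 0 < L) :
    (#(I.longQubits L) : ℝ) ≤ w * genConst A r b * n / L ^ 2 := by
  classical
  have h1 : #(I.longQubits L) ≤ #(I.longGens L) * w :=
    Finset.card_biUnion_le_card_mul _ _ _ fun g _ => I.card_supp_le g
  calc (#(I.longQubits L) : ℝ) ≤ #(I.longGens L) * w := by exact_mod_cast h1
    _ ≤ genConst A r b * n / L ^ 2 * w := by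
      have := I.card_longGens_le hr hL
      gcongr
    _ = _ := by ring

open Classical in
/-- A square of side length `2 R` contains few qubits that are touched by generators of diameter
between `L` and `2 R`. -/
theorem card_longQubits_box_le (hr : 0 < r) {L R : ℝ} (hL : 0 < L) (hR : 0 < R) {a c : ℝ}
    (F : Finset (Fin n)) (hF : ∀ q ∈ F, q ∈ I.longQubits L ∧ q ∉ I.longQubits (2 * R) ∧
      (a ≤ I.pos q 0 ∧ I.pos q 0 ≤ a + 2 * R) ∧ c ≤ I.pos q 1 ∧ I.pos q 1 ≤ c + 2 * R) :
    (#F : ℝ) ≤ 534 * w * b * (R / L) ^ 2 := by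
  let G : Finset (Fin I.numGen) :=
    {g | L ≤ 2 * (r * 2 ^ I.layer g) ∧ 2 * (r * 2 ^ I.layer g) ≤ 2 * R ∧ ∃ q ∈ I.supp g,
      (a ≤ I.pos q 0 ∧ I.pos q 0 ≤ a + 2 * R) ∧ c ≤ I.pos q 1 ∧ I.pos q 1 ≤ c + 2 * R}
  have h1 : #F ≤ #G * w := by
    refine (Finset.card_le_card (t := G.biUnion I.supp) fun q hq => ?_).trans
      (Finset.card_biUnion_le_card_mul _ _ _ fun g _ => I.card_supp_le g)
    obtain ⟨h1, h2, h3⟩ := hF q hq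
    obtain ⟨g, hg, hqg⟩ := I.mem_longQubits.1 h1
    rw [Finset.mem_biUnion]
    refine ⟨g, ?_, hqg⟩
    simp only [G, Finset.mem_filter, Finset.mem_univ, true_and]
    refine ⟨(I.mem_longGens.1 hg).2, ?_, q, hqg, h3⟩
    by_contra h
    exact h2 (I.mem_longQubits.2 ⟨g, I.mem_longGens.2 ⟨⟨q, hqg⟩, (not_le.1 h).le⟩, hqg⟩)
  have h2 : (#G : ℝ) ≤ 4 / 3 * (b * (100 * R ^ 2 / r ^ 2)) / (L / (2 * r)) ^ 2 := by
    refine card_le_of_card_layer_le G I.layer (by positivity) (by positivity) (fun i => ?_)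
      fun g hg => ?_
    · by_cases hi : ∃ g ∈ G, I.layer g = i
      · obtain ⟨g₀, hg₀, rfl⟩ := hi
        have hle := (Finset.mem_filter.1 hg₀).2.2.1
        set i := I.layer g₀
        refine (I.card_layer_touching_le hr i (a := a) (c := c) (s := 2 * R) (by positivity) _
          (fun g hg => (Finset.mem_filter.1 hg).2) (fun g hg => ?_)).trans ?_
        · exact (Finset.mem_filter.1 (Finset.mem_filter.1 hg).1).2.2.2
        · have h3 : 2 * (2 * R) / (r * 2 ^ i) + 6 ≤ 10 * (R / (r * 2 ^ i)) := by
            have : 1 ≤ R / (r * 2 ^ i) := by rw [one_le_div (by positivity)]; linarith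
            have e : 2 * (2 * R) / (r * 2 ^ i) = 4 * (R / (r * 2 ^ i)) := by ring
            rw [e]
            linarith
          calc (b : ℝ) * (2 * (2 * R) / (r * 2 ^ i) + 6) ^ 2
              ≤ b * (10 * (R / (r * 2 ^ i))) ^ 2 := by gcongr
            _ = b * (100 * R ^ 2 / r ^ 2) / 4 ^ i := by
              have h4 : (4 : ℝ) ^ i = 2 ^ i * 2 ^ i := by rw [← mul_pow]; norm_num
              rw [h4]
              field_simp
              ring
      · rw [Finset.filter_eq_empty_iff.2 fun g hg h => hi ⟨g, hg, h⟩]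
        simp only [Finset.card_empty, Nat.cast_zero]
        positivity
    · rw [div_le_iff₀ (by positivity)]
      have := (Finset.mem_filter.1 hg).2.1
      linarith
  calc (#F : ℝ) ≤ #G * w := by exact_mod_cast h1
    _ ≤ 4 / 3 * (b * (100 * R ^ 2 / r ^ 2)) / (L / (2 * r)) ^ 2 * w := by gcongr
    _ = 1600 / 3 * (w * b * (R / L) ^ 2) := by field_simp; ring
    _ ≤ 534 * (w * b * (R / L) ^ 2) := by gcongr; norm_num
    _ = _ := by ring

end StackedImplementation

/-! ### Parameter bounds at a given length scale -/

/-- The coordinate of a point that lies in one of the cells `i, …, j` of side length `L`. -/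
theorem mem_Icc_of_floor_div {z L : ℝ} (hL : 0 < L) {i j : ℤ} (h : i ≤ ⌊z / L⌋ ∧ ⌊z / L⌋ ≤ j) :
    i * L ≤ z ∧ z ≤ i * L + (j - i + 1) * L := by
  have h1 : (i : ℝ) ≤ z / L := Int.le_floor.1 h.1
  have h2 : z / L < j + 1 := by
    have : (⌊z / L⌋ : ℝ) ≤ j := by exact_mod_cast h.2
    have := Int.lt_floor_add_one (z / L)
    linarith
  rw [le_div_iff₀ hL] at h1
  rw [div_lt_iff₀ hL] at h2
  constructor <;> linarith

namespace StackedImplementation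
variable {A r : ℝ} {w b n : ℕ} {𝒞 : StabilizerCode n} (I : StackedImplementation A r w b 𝒞)
  {k d : ℕ}

/-- At scale `L`, a stacked implementation is a local code; the bad qubits are those touched by
generators of diameter at least `L`. -/
theorem exists_localCode (h : 𝒞.HasParameters k d) {L : ℝ} (hL : 0 < L) :
    ∃ H : LocalCode n d, Module.finrank (ZMod 2) H.S + k = n ∧
      (∀ q, H.x q = ⌊I.pos q 0 / L⌋) ∧ (∀ q, H.y q = ⌊I.pos q 1 / L⌋) ∧
      H.bad = I.longQubits L := by
  obtain ⟨Γ, hΓ, hspan⟩ := StabilizerCode.exists_bits_gen I.closure_gen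
  have hdist : ∀ i p q, Γ i p ≠ 0 → Γ i q ≠ 0 → p ∉ I.longQubits L →
      dist (I.pos p) (I.pos q) ≤ L := by
    intro i p q hp hq hb
    rw [← hΓ] at hp hq
    have hshort : 2 * (r * 2 ^ I.layer i) < L := by
      by_contra hlong
      have hpi := I.mem_supp.2 hp
      exact hb (I.mem_longQubits.2
        ⟨i, I.mem_longGens.2 ⟨⟨p, hpi⟩, not_lt.1 hlong⟩, hpi⟩)
    have h2 := dist_triangle_right (I.pos p) (I.pos q) (I.center i)
    have h3 := Metric.mem_closedBall.1 (I.support_subset i p hp)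
    have h4 := Metric.mem_closedBall.1 (I.support_subset i q hq)
    linarith
  exact ⟨{
    S := 𝒞.bitSpace
    ι := Fin I.numGen
    Γ := Γ
    span_eq := hspan
    isotropic := 𝒞.bitSpace_le_orthogonal
    correctable_of_card_lt := fun M hM => h.correctable hM
    x := fun q => ⌊I.pos q 0 / L⌋
    y := fun q => ⌊I.pos q 1 / L⌋
    bad := I.longQubits L
    local_x := fun i p q hp hq hb => floor_div_sub_le_one hL
      ((I.abs_coord_sub_le p q 0).trans (hdist i p q hp hq hb))
    local_y := fun i p q hp hq hb => floor_div_sub_le_one hL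
      ((I.abs_coord_sub_le p q 1).trans (hdist i p q hp hq hb)) },
    StabilizerCode.finrank_bitSpace_add h.1, fun _ => rfl, fun _ => rfl, rfl⟩

/-- If the bad qubits and each column had fewer than `d` qubits in total, then the good qubits could
be swept column by column, and there would be no logical operators. -/
theorem d_le_of_scale (I : StackedImplementation A r w b 𝒞) (h : 𝒞.HasParameters k d)
    (hr : 0 < r) (hA : 0 < A) (hn : 1 ≤ n) {L : ℝ} (hL : 1 ≤ L) :
    (d : ℝ) ≤ w * genConst A r b * n / L ^ 2 + 8 * (A + 1) * L * √n := by
  have hL0 : 0 < L := by linarith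
  obtain ⟨H, hk, hx, -, hbad⟩ := I.exists_localCode h hL0
  by_contra! hlt
  have hV := I.card_longQubits_le hr hL0
  have hsn : 1 ≤ √(n : ℝ) := by rw [Real.one_le_sqrt]; exact_mod_cast hn
  have hcol : ∀ j, H.bad.card + #{q | H.x q = j} < d := by
    intro j
    have h1 := I.card_qubits_le (a := j * L) (c := I.corner 1) (s := L) (t := A * √n) hL0.le
      (by positivity) {q | H.x q = j} fun q hq => ?_
    · have h2 : (2 * L + 2) * (2 * (A * √n) + 2) ≤ 8 * (A + 1) * L * √n := by
        calc (2 * L + 2) * (2 * (A * √n) + 2) ≤ (2 * L + 2 * L) * (2 * (A * √n) + 2 * √n) := by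
              gcongr <;> linarith
          _ = _ := by ring
      rw [hbad]
      have : ((#(I.longQubits L) + #{q | H.x q = j} : ℕ) : ℝ) < d := by
        push_cast; linarith
      exact_mod_cast this
    · have hq := (Finset.mem_filter.1 hq).2
      rw [hx] at hq
      refine ⟨?_, I.pos_mem q 1⟩
      have := mem_Icc_of_floor_div hL0 ⟨hq.ge, hq.le⟩
      rwa [sub_self, zero_add, one_mul] at this
  have h1 := H.correctable_compl_bad hcol
  have h2 := H.correctable_of_card_lt H.bad ((Nat.le_add_right _ _).trans_lt (hcol 0))
  rw [← defectLE_zero_iff H.isotropic] at h1 h2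
  have h3 := DefectLE.le_card_add (e := 0) hk h1 h2 (C := ∅) disjoint_compl_left fun q => by
    by_cases hq : q ∈ H.bad <;> simp [hq]
  have h4 := h.one_le_k
  simp at h3
  lia

/-- A strip of length `J + 1` and width one, in cells of side length `L`, has `O(J L ^ 2)` qubits
since their distances are at least one. -/
theorem stripLE_of_localCode {L : ℝ} (hL : 1 ≤ L) {H : LocalCode n d}
    (hx : ∀ q, H.x q = ⌊I.pos q 0 / L⌋) (hy : ∀ q, H.y q = ⌊I.pos q 1 / L⌋) {J : ℕ}
    (hJ : 1 ≤ J) : H.StripLE J ⌊24 * J * L ^ 2⌋₊ := by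
  have hL0 : 0 < L := by linarith
  have hJ' : (1 : ℝ) ≤ J := by exact_mod_cast hJ
  have key : (2 * L + 2) * (2 * ((J + 1) * L) + 2) ≤ 24 * J * L ^ 2 := by
    calc (2 * L + 2) * (2 * ((J + 1) * L) + 2)
        ≤ (2 * L + 2 * L) * (2 * ((J + J) * L) + 2 * (J * L)) := by
          gcongr
          · linarith
          · nlinarith
      _ = _ := by ring
  refine ⟨fun a c => Nat.le_floor ?_, fun a c => Nat.le_floor ?_⟩
  · refine (I.card_qubits_le (a := a * L) (c := c * L) (s := L) (t := (J + 1) * L) hL0.le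
      (by positivity) _ fun q hq => ?_).trans key
    obtain ⟨hq1, hq2⟩ := (Finset.mem_filter.1 hq).2
    rw [hx] at hq1
    rw [hy] at hq2
    have h1 := mem_Icc_of_floor_div hL0 ⟨hq1.ge, hq1.le⟩
    have h2 := mem_Icc_of_floor_div hL0 hq2
    push_cast at h1 h2
    rw [sub_self, zero_add, one_mul] at h1
    rw [add_sub_cancel_left] at h2
    exact ⟨h1, h2⟩
  · refine (I.card_qubits_le (a := a * L) (c := c * L) (t := L) (s := (J + 1) * L)
      (by positivity) hL0.le _ fun q hq => ?_).trans (by rw [mul_comm]; exact key)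
    obtain ⟨hq1, hq2⟩ := (Finset.mem_filter.1 hq).2
    rw [hy] at hq1
    rw [hx] at hq2
    have h1 := mem_Icc_of_floor_div hL0 ⟨hq1.ge, hq1.le⟩
    have h2 := mem_Icc_of_floor_div hL0 hq2
    push_cast at h1 h2
    rw [sub_self, zero_add, one_mul] at h1
    rw [add_sub_cancel_left] at h2
    exact ⟨h2, h1⟩

/-- The bound on the number of logical qubits when long generators touch fewer than `d` qubits. -/
theorem mul_sq_le_of_few_long (I : StackedImplementation A r w b 𝒞)
    (h : 𝒞.HasParameters k d) (hr : 0 < r) {L : ℝ} (hL : 1 ≤ L) {J : ℕ}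
    (hJ : 2 ≤ J) (hd : w * genConst A r b * n / L ^ 2 + 120 * J * L ^ 2 < d) :
    (k : ℝ) * J ^ 2 ≤ 3 * n + 10 * J * (w * genConst A r b * n / L ^ 2) := by
  have hL0 : 0 < L := by linarith
  obtain ⟨H, hk, hx, hy, hbad⟩ := I.exists_localCode h hL0
  have hV := I.card_longQubits_le hr hL0
  have hP := I.stripLE_of_localCode hL hx hy (J := J) (by lia)
  have hfl : (⌊24 * J * L ^ 2⌋₊ : ℝ) ≤ 24 * J * L ^ 2 := Nat.floor_le (by positivity)
  have h1 := H.mul_sq_le_of_card_bad hk hJ hP (by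
    have : ((#H.bad + 5 * ⌊24 * J * L ^ 2⌋₊ : ℕ) : ℝ) < d := by
      rw [hbad]; push_cast; linarith
    exact_mod_cast this)
  rw [hbad] at h1
  calc (k : ℝ) * J ^ 2 ≤ 3 * n + 10 * J * #(I.longQubits L) := by exact_mod_cast h1
    _ ≤ _ := by gcongr

open Classical in
/-- The heavy squares contain few qubits. By the layered structure, a square contains few qubits
touched by generators that are long, but not longer than the square. So a heavy square
contains many qubits touched by generators longer than the square, and there are few of these. -/
theorem card_heavy_le (hr : 0 < r) {L : ℝ} (hL : 1 ≤ L) {J : ℕ} (hJ : 1 ≤ J)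
    (hd : 120 * J * L ^ 2 ≤ d / 4) (hd' : 534 * w * b * (J : ℝ) ^ 2 ≤ d / 4) {H : LocalCode n d}
    (hx : ∀ q, H.x q = ⌊I.pos q 0 / L⌋) (hy : ∀ q, H.y q = ⌊I.pos q 1 / L⌋)
    (hbad : H.bad = I.longQubits L) (s t : ℤ) :
    (#{q | (H.shift s t).Heavy J ⌊24 * J * L ^ 2⌋₊ q} : ℝ) ≤
      32 * (w * genConst A r b * n / d) := by
  have hL0 : 0 < L := by linarith
  have hJ' : (1 : ℝ) ≤ J := by exact_mod_cast hJ
  have hJ0 : (0 : ℤ) < J := by exact_mod_cast hJ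
  have hd0 : (0 : ℝ) < d := by
    have : 0 < 120 * J * L ^ 2 := by positivity
    linarith
  set P := ⌊24 * J * L ^ 2⌋₊
  have hP : (P : ℝ) ≤ 24 * J * L ^ 2 := Nat.floor_le (by positivity)
  set V₂ := I.longQubits (2 * (J * L))
  set cell : Fin n → ℤ × ℤ := fun q => ((H.x q - s) / J, (H.y q - t) / J)
  set Q : Finset (Fin n) := {q | (H.shift s t).Heavy J P q}
  set HC := Q.image cell
  let bx (c : ℤ × ℤ) := (H.shift s t).box J (J * c.1) (J * c.2)
  have hbx : ∀ c q, q ∈ bx c ↔ (J * c.1 ≤ H.x q - s ∧ H.x q - s ≤ J * c.1 + J) ∧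
      J * c.2 ≤ H.y q - t ∧ H.y q - t ≤ J * c.2 + J := by
    intro c q
    simp [bx, LocalCode.box, LocalCode.shift, and_assoc]
  -- A heavy square contains many qubits of `V₂`.
  have h1 : ∀ c ∈ HC, (d : ℝ) / 2 ≤ #(V₂ ∩ bx c) := by
    intro c hc
    obtain ⟨q, hq, rfl⟩ := Finset.mem_image.1 hc
    have hq : d ≤ #(H.bad ∩ bx (cell q)) + 5 * P := (Finset.mem_filter.1 hq).2
    have hsplit : H.bad ∩ bx (cell q) ⊆
        (H.bad ∩ bx (cell q)) \ V₂ ∪ V₂ ∩ bx (cell q) := by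
      intro p hp
      rw [Finset.mem_inter] at hp
      by_cases h : p ∈ V₂ <;> simp [hp, h]
    have h2 := (Finset.card_le_card hsplit).trans (Finset.card_union_le _ _)
    have h3 := I.card_longQubits_box_le hr hL0 (R := J * L) (by positivity)
      (a := ((J * (cell q).1 + s : ℤ) : ℝ) * L) (c := ((J * (cell q).2 + t : ℤ) : ℝ) * L)
      ((H.bad ∩ bx (cell q)) \ V₂) (fun p hp => by
        rw [Finset.mem_sdiff, Finset.mem_inter, hbad, hbx, hx, hy] at hp
        refine ⟨hp.1.1, hp.2, ?_, ?_⟩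
        · have := mem_Icc_of_floor_div hL0 (z := I.pos p 0) (i := J * (cell q).1 + s)
            (j := J * (cell q).1 + s + J) ⟨by lia, by lia⟩
          refine ⟨this.1, this.2.trans ?_⟩
          push_cast
          nlinarith
        · have := mem_Icc_of_floor_div hL0 (z := I.pos p 1) (i := J * (cell q).2 + t)
            (j := J * (cell q).2 + t + J) ⟨by lia, by lia⟩
          refine ⟨this.1, this.2.trans ?_⟩
          push_cast
          nlinarith)
    rw [mul_div_cancel_right₀ _ hL0.ne'] at h3
    have h4 : (d : ℝ) ≤ #((H.bad ∩ bx (cell q)) \ V₂) + #(V₂ ∩ bx (cell q)) + 5 * P := by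
      exact_mod_cast hq.trans (Nat.add_le_add_right h2 _)
    linarith
  -- Every qubit is in at most four of the squares.
  have h2 : ∑ c ∈ HC, #(V₂ ∩ bx c) ≤ 4 * #V₂ := by
    calc ∑ c ∈ HC, #(V₂ ∩ bx c) = ∑ c ∈ HC, ∑ q ∈ V₂, if q ∈ bx c then 1 else 0 := by
          refine Finset.sum_congr rfl fun c _ => ?_
          rw [← Finset.filter_mem_eq_inter, Finset.card_filter]
      _ = ∑ q ∈ V₂, #{c ∈ HC | q ∈ bx c} := by
          rw [Finset.sum_comm]
          exact Finset.sum_congr rfl fun q _ => (Finset.card_filter _ _).symm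
      _ ≤ ∑ q ∈ V₂, 4 := by
          refine Finset.sum_le_sum fun q _ => ?_
          have hone : ∀ z c : ℤ, J * c ≤ z → z ≤ J * c + J → c = z / J - 1 ∨ c = z / J := by
            intro z c h1 h2
            have h3 : c ≤ z / J := (Int.le_ediv_iff_mul_le hJ0).2 (by linarith)
            have h4 : z / J ≤ c + 1 := by
              rw [Int.ediv_le_iff_le_mul hJ0]
              nlinarith
            lia
          refine (Finset.card_le_card (t := {(H.x q - s) / J - 1, (H.x q - s) / J} ×ˢ
            {(H.y q - t) / J - 1, (H.y q - t) / J}) fun c hc => ?_).trans ?_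
          · have hc := (hbx c q).1 (Finset.mem_filter.1 hc).2
            simpa using ⟨hone _ _ hc.1.1 hc.1.2, hone _ _ hc.2.1 hc.2.2⟩
          · rw [Finset.card_product]
            exact Nat.mul_le_mul Finset.card_le_two Finset.card_le_two
      _ = 4 * #V₂ := by simp [mul_comm]
  have h3 : (#Q : ℝ) ≤ #HC * (16 * (J * L) ^ 2) := by
    have hfib : ∀ c ∈ HC, #{q ∈ Q | cell q = c} ≤ ⌊16 * (J * L) ^ 2⌋₊ := by
      intro c _
      refine Nat.le_floor ((I.card_qubits_le (a := ((J * c.1 + s : ℤ) : ℝ) * L)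
        (c := ((J * c.2 + t : ℤ) : ℝ) * L) (s := J * L) (t := J * L) (by positivity)
        (by positivity) _ fun q hq => ?_).trans ?_)
      · have hc := (Finset.mem_filter.1 hq).2
        have e1 : (H.x q - s) / J = c.1 := congrArg Prod.fst hc
        have e2 : (H.y q - t) / J = c.2 := congrArg Prod.snd hc
        have g1 := Int.mul_ediv_add_emod (H.x q - s) J
        have g2 := Int.emod_nonneg (H.x q - s) hJ0.ne'
        have g3 := Int.emod_lt_of_pos (H.x q - s) hJ0
        have g4 := Int.mul_ediv_add_emod (H.y q - t) J
        have g5 := Int.emod_nonneg (H.y q - t) hJ0.ne'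
        have g6 := Int.emod_lt_of_pos (H.y q - t) hJ0
        rw [e1] at g1
        rw [e2] at g4
        rw [hx] at *
        rw [hy] at *
        have k1 := mem_Icc_of_floor_div hL0 (z := I.pos q 0) (i := J * c.1 + s)
            (j := J * c.1 + s + J - 1) ⟨by lia, by lia⟩
        have k2 := mem_Icc_of_floor_div hL0 (z := I.pos q 1) (i := J * c.2 + t)
            (j := J * c.2 + t + J - 1) ⟨by lia, by lia⟩
        refine ⟨⟨k1.1, k1.2.trans_eq ?_⟩, k2.1, k2.2.trans_eq ?_⟩ <;> push_cast <;> ring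
      · have : 1 ≤ J * L := by nlinarith
        nlinarith
    have := Finset.card_le_mul_card_image Q _ hfib
    have hfl : (⌊16 * (J * L) ^ 2⌋₊ : ℝ) ≤ 16 * (J * L) ^ 2 := Nat.floor_le (by positivity)
    calc (#Q : ℝ) ≤ ⌊16 * (J * L) ^ 2⌋₊ * #HC := by exact_mod_cast this
      _ ≤ 16 * (J * L) ^ 2 * #HC := by gcongr
      _ = _ := by ring
  have h4 : #HC * ((d : ℝ) / 2) ≤ 4 * #V₂ := by
    calc #HC * ((d : ℝ) / 2) = ∑ c ∈ HC, (d : ℝ) / 2 := by simp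
      _ ≤ ∑ c ∈ HC, (#(V₂ ∩ bx c) : ℝ) := Finset.sum_le_sum h1
      _ ≤ 4 * #V₂ := by exact_mod_cast h2
  have h5 := I.card_longQubits_le hr (L := 2 * (J * L)) (by positivity)
  calc (#Q : ℝ) ≤ #HC * (16 * (J * L) ^ 2) := h3
    _ = #HC * ((d : ℝ) / 2) * (32 * (J * L) ^ 2 / d) := by field_simp; ring
    _ ≤ 4 * (w * genConst A r b * n / (2 * (J * L)) ^ 2) * (32 * (J * L) ^ 2 / d) := by
      exact mul_le_mul_of_nonneg_right (h4.trans (by gcongr)) (by positivity)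
    _ = _ := by field_simp; ring

/-- The bound on the number of logical qubits that does not need a bound for the number of qubits
touched by long generators in terms of the distance. -/
theorem mul_sq_le_of_short_squares (I : StackedImplementation A r w b 𝒞)
    (h : 𝒞.HasParameters k d) (hr : 0 < r) {L : ℝ} (hL : 1 ≤ L)
    {J : ℕ} (hJ : 2 ≤ J) (hd : 120 * J * L ^ 2 ≤ d / 4)
    (hd' : 534 * w * b * (J : ℝ) ^ 2 ≤ d / 4) :
    (k : ℝ) * J ^ 2 ≤ 3 * n + (w * genConst A r b * n / L ^ 2 +
      32 * (w * genConst A r b * n / d)) * J ^ 2 := by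
  classical
  have hL0 : 0 < L := by linarith
  have hJ' : (2 : ℝ) ≤ J := by exact_mod_cast hJ
  obtain ⟨H, hk, hx, hy, hbad⟩ := I.exists_localCode h hL0
  have hV := I.card_longQubits_le hr hL0
  have hP := I.stripLE_of_localCode hL hx hy (J := J) (by lia)
  have hfl : (⌊24 * J * L ^ 2⌋₊ : ℝ) ≤ 24 * J * L ^ 2 := Nat.floor_le (by positivity)
  have hJL : 0 < J * L ^ 2 := by positivity
  have hheavy := I.card_heavy_le hr hL (by lia) hd hd' hx hy hbad
  have h0 : 0 ≤ 32 * (w * genConst A r b * n / d) := (Nat.cast_nonneg _).trans (hheavy 0 0)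
  have h1 := H.mul_sq_le_of_heavy hk hJ hP (by
    have : (⌊24 * J * L ^ 2⌋₊ : ℝ) < d := by linarith
    exact_mod_cast this) (h := ⌊32 * (w * genConst A r b * n / d)⌋₊)
    fun s t => Nat.le_floor (hheavy s t)
  rw [hbad] at h1
  calc (k : ℝ) * J ^ 2
      ≤ 3 * n + (#(I.longQubits L) + ⌊32 * (w * genConst A r b * n / d)⌋₊) * J ^ 2 := by
        exact_mod_cast h1
    _ ≤ _ := by
      have := Nat.floor_le h0
      gcongr

end StackedImplementation

/-! ### Optimizing the length scale -/

namespace StackedImplementation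
variable {A r : ℝ} {w b n : ℕ} {𝒞 : StabilizerCode n} {k d : ℕ}

theorem genConst_nonneg (A r : ℝ) (b : ℕ) : 0 ≤ genConst A r b := by
  unfold genConst; positivity

theorem k_le_n (h : 𝒞.HasParameters k d) : k ≤ n := by
  have := StabilizerCode.finrank_bitSpace_add h.1
  lia

/-- The constant in the bound on the distance. -/
noncomputable def distConst (A r : ℝ) (w b : ℕ) : ℝ :=
  1728 * (w * genConst A r b) * (A + 1) ^ 2 + (24 * (A + 1)) ^ 3

theorem distConst_nonneg (hA : 0 < A) : 0 ≤ distConst A r w b := by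
  have := genConst_nonneg A r b
  unfold distConst; positivity

/-- The bound on the distance comes from the length scale proportional to `d / √n`, at which a
column of cells has at most `d / 3` qubits. -/
theorem d_pow_three_le (I : StackedImplementation A r w b 𝒞) (h : 𝒞.HasParameters k d)
    (hr : 0 < r) (hA : 0 < A) : (d : ℝ) ^ 3 ≤ distConst A r w b * n ^ 2 := by
  have hn : 1 ≤ n := h.one_le_k.trans (k_le_n h)
  have hn' : (1 : ℝ) ≤ n := by exact_mod_cast hn
  by_contra! hlt
  unfold distConst at hlt
  set c : ℝ := w * genConst A r b with hc
  have hc0 : 0 ≤ c := mul_nonneg (Nat.cast_nonneg _) (genConst_nonneg A r b)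
  set s := √(n : ℝ) with hs
  have hs1 : 1 ≤ s := by rw [hs, Real.one_le_sqrt]; exact hn'
  have hs2 : s ^ 2 = n := Real.sq_sqrt (by positivity)
  have hd : 24 * (A + 1) * s < d := by
    refine lt_of_pow_lt_pow_left₀ 3 (by positivity) (lt_of_le_of_lt ?_ hlt)
    have h1 : s ^ 3 ≤ (n : ℝ) ^ 2 := by rw [← hs2, ← pow_mul]; exact pow_le_pow_right₀ hs1 (by simp)
    calc (24 * (A + 1) * s) ^ 3 = (24 * (A + 1)) ^ 3 * s ^ 3 := by ring
      _ ≤ (24 * (A + 1)) ^ 3 * (n : ℝ) ^ 2 := by gcongr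
      _ ≤ _ := by
        have : 0 ≤ 1728 * c * (A + 1) ^ 2 * (n : ℝ) ^ 2 := by positivity
        linarith
  have hd0 : (0 : ℝ) < d := lt_of_le_of_lt (by positivity) hd
  have h1 := I.d_le_of_scale h hr hA hn (L := d / (24 * (A + 1) * s))
    (by rw [one_le_div (by positivity)]; exact hd.le)
  rw [← hc, ← hs] at h1
  have e1 : 8 * (A + 1) * (d / (24 * (A + 1) * s)) * s = d / 3 := by field_simp; norm_num
  have e2 : c * n / (d / (24 * (A + 1) * s)) ^ 2 = 576 * c * (A + 1) ^ 2 * n ^ 2 / d ^ 2 := by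
    rw [← hs2]; field_simp; ring
  rw [e1, e2] at h1
  have h2 : 2 / 3 * d * (d : ℝ) ^ 2 ≤ 576 * c * (A + 1) ^ 2 * n ^ 2 := by
    rw [← le_div_iff₀ (by positivity)]; linarith
  have h3 : 0 ≤ c * (A + 1) ^ 2 * (n : ℝ) ^ 2 := by positivity
  have h4 : 0 ≤ (24 * (A + 1)) ^ 3 * (n : ℝ) ^ 2 := by positivity
  have h5 : 0 < (d : ℝ) ^ 3 := by positivity
  nlinarith

/-- A lower bound on `k d / n` that suffices for the rate-distance tradeoff. -/
noncomputable def rateConst (A r : ℝ) (w b : ℕ) : ℝ :=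
  9216000 + 192000 * (w * genConst A r b) + 85440 * w * b

/-- The bound for `k d ≥ K n`. The squares have side length `J L` with `L ^ 4 = ε k d ^ 2 / n`
and `J` proportional to `d / L ^ 2`, so that their edges have fewer than `d` qubits, while their
corners make up a fraction `J ^ (-2)`, that is a small multiple of `k / n`, of all qubits. -/
theorem k_mul_d_le_of_rate (I : StackedImplementation A r w b 𝒞) (h : 𝒞.HasParameters k d)
    (hr : 0 < r) (hkd : rateConst A r w b * n ≤ k * d) :
    (k : ℝ) * d ^ 2 * max (k : ℝ) d ^ 2 ≤ 147456000 * (w * genConst A r b) ^ 2 * n ^ 3 := by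
  have hk := h.one_le_k
  have hkn := k_le_n h
  have hk1 : (1 : ℝ) ≤ k := by exact_mod_cast hk
  have hkn' : (k : ℝ) ≤ n := by exact_mod_cast hkn
  have hk0 : (0 : ℝ) < k := by linarith
  have hn0 : (0 : ℝ) < n := by linarith
  by_contra! hlt
  unfold rateConst at hkd
  set c : ℝ := w * genConst A r b with hc
  have hc0 : 0 ≤ c := mul_nonneg (Nat.cast_nonneg _) (genConst_nonneg A r b)
  have hwb : (0 : ℝ) ≤ w * b := by positivity
  have hd1 : (1 : ℝ) ≤ d := by
    rcases Nat.eq_zero_or_pos d with rfl | hd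
    · simp at hlt
      have : 0 ≤ 147456000 * c ^ 2 * (n : ℝ) ^ 3 := by positivity
      linarith
    · exact_mod_cast hd
  have hd0 : (0 : ℝ) < d := by linarith
  -- `rateConst` is such that `J ≥ 2` and `L ≥ 1`, and that few squares are heavy.
  have hK1 : 9216000 * (n : ℝ) ≤ k * d := by
    linarith [mul_nonneg hc0 hn0.le, mul_nonneg hwb hn0.le]
  have hK2 : 192000 * c * (n : ℝ) ≤ k * d := by
    linarith [mul_nonneg hc0 hn0.le, mul_nonneg hwb hn0.le]
  have hK3 : 85440 * (w * b) * (n : ℝ) ≤ k * d := by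
    linarith [mul_nonneg hc0 hn0.le, mul_nonneg hwb hn0.le]
  -- A multiple of the number `J` of cells along the edge of a square.
  set μ : ℝ := √(9216000 * n / k) with hμ
  have hμ2 : μ ^ 2 = 9216000 * n / k := Real.sq_sqrt (by positivity)
  have hμ0 : 0 < μ := by rw [hμ, Real.sqrt_pos]; positivity
  have hkμ : k * μ ^ 2 = 9216000 * n := by rw [hμ2]; field_simp
  have hμ480 : 6 ≤ μ / 480 := by
    rw [le_div_iff₀ (by norm_num)]
    refine le_of_pow_le_pow_left₀ two_ne_zero hμ0.le ?_
    rw [hμ2, le_div_iff₀ hk0]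
    linarith
  set J : ℕ := ⌊μ / 480⌋₊ with hJ
  have hJle : (J : ℝ) ≤ μ / 480 := Nat.floor_le (by positivity)
  have hJlt : μ / 480 < J + 1 := Nat.lt_floor_add_one _
  have hJge : μ / 960 ≤ J := by linarith
  have hJ2 : 2 ≤ J := Nat.le_floor (by norm_num; linarith)
  have hJ0 : (0 : ℝ) < J := by have : (2 : ℝ) ≤ J := by exact_mod_cast hJ2
                               linarith
  have hkJ : 10 * n ≤ k * (J : ℝ) ^ 2 := by
    calc 10 * (n : ℝ) = k * μ ^ 2 / 921600 := by rw [hkμ]; ring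
      _ = k * (μ / 960) ^ 2 := by ring
      _ ≤ k * (J : ℝ) ^ 2 := by gcongr
  have hkJ' : k * (J : ℝ) ^ 2 ≤ 40 * n := by
    calc k * (J : ℝ) ^ 2 ≤ k * (μ / 480) ^ 2 := by gcongr
      _ = k * μ ^ 2 / 230400 := by ring
      _ = 40 * n := by rw [hkμ]; ring
  -- `lam` is the square of the length scale.
  set lam : ℝ := d / μ with hlam
  have hlam0 : 0 < lam := by positivity
  have hlamμ : lam * μ = d := by rw [hlam]; field_simp
  have hlam2 : 9216000 * n * lam ^ 2 = k * d ^ 2 := by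
    rw [← hkμ, ← hlamμ]; ring
  have hlam1 : 1 ≤ lam := by
    refine le_of_pow_le_pow_left₀ two_ne_zero hlam0.le ?_
    have : 9216000 * (n : ℝ) * 1 ≤ 9216000 * n * lam ^ 2 := by
      calc 9216000 * (n : ℝ) * 1 ≤ k * d * 1 := by linarith
        _ ≤ k * d * d := by gcongr
        _ = 9216000 * n * lam ^ 2 := by rw [hlam2]; ring
    rw [one_pow]
    exact le_of_mul_le_mul_left this (by positivity)
  have hsq : √lam ^ 2 = lam := Real.sq_sqrt hlam0.le
  have hL : 1 ≤ √lam := by rwa [Real.one_le_sqrt]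
  have hstrip : 120 * J * lam ≤ d / 4 := by
    calc 120 * J * lam ≤ 120 * (μ / 480) * lam := by gcongr
      _ = lam * μ / 4 := by ring
      _ = d / 4 := by rw [hlamμ]
  -- The number of long qubits is small compared to `max k d`.
  have hlong : c * n / lam ≤ max (k : ℝ) d / 4 := by
    rw [div_le_div_iff₀ hlam0 (by norm_num)]
    refine le_of_pow_le_pow_left₀ two_ne_zero (by positivity) ?_
    have h1 : 9216000 * n * (c * n * 4) ^ 2 ≤ 9216000 * n * (max (k : ℝ) d * lam) ^ 2 := by
      calc 9216000 * n * (c * n * 4) ^ 2 = 147456000 * c ^ 2 * n ^ 3 := by ring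
        _ ≤ k * d ^ 2 * max (k : ℝ) d ^ 2 := hlt.le
        _ = 9216000 * n * (max (k : ℝ) d * lam) ^ 2 := by rw [← hlam2]; ring
    exact le_of_mul_le_mul_left h1 (by positivity)
  rcases le_total (d : ℝ) k with hdk | hkd'
  · rw [max_eq_left hdk] at hlong
    have h534 : 534 * w * b * (J : ℝ) ^ 2 ≤ d / 4 := by
      refine le_of_mul_le_mul_left ?_ hk0
      calc (k : ℝ) * (534 * w * b * (J : ℝ) ^ 2)
            = 534 * ((w : ℝ) * b) * (k * (J : ℝ) ^ 2) := by ring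
        _ ≤ 534 * ((w : ℝ) * b) * (40 * n) := by gcongr
        _ = 85440 * ((w : ℝ) * b) * n / 4 := by ring
        _ ≤ (k : ℝ) * d / 4 := by linarith
        _ = (k : ℝ) * ((d : ℝ) / 4) := by ring
    have h1 := I.mul_sq_le_of_short_squares h hr hL hJ2 (by rwa [hsq]) h534
    rw [← hc, hsq] at h1
    have h2 : 32 * (c * n / d) ≤ k / 4 := by
      rw [← mul_div_assoc, div_le_div_iff₀ hd0 (by norm_num)]
      linarith [mul_nonneg hc0 hn0.le]
    have h3 : (c * n / lam + 32 * (c * n / d)) * (J : ℝ) ^ 2 ≤ k / 2 * (J : ℝ) ^ 2 := by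
      gcongr; linarith
    linarith
  · rw [max_eq_right hkd'] at hlong
    have h1 := I.mul_sq_le_of_few_long h hr hL hJ2 (by rw [← hc, hsq]; linarith)
    rw [← hc, hsq] at h1
    have h2 : 10 * J * (c * n / lam) ≤ n := by
      rw [← mul_div_assoc, div_le_iff₀ hlam0]
      have h3 : c * μ ≤ 48 * lam := by
        refine le_of_mul_le_mul_right ?_ (mul_pos hk0 hμ0)
        calc c * μ * (k * μ) = c * (k * μ ^ 2) := by ring
          _ = 48 * (192000 * c * n) := by rw [hkμ]; ring
          _ ≤ 48 * (k * d) := by gcongr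
          _ = 48 * lam * (k * μ) := by rw [← hlamμ]; ring
      calc 10 * J * (c * n) = 10 * n * (c * J) := by ring
        _ ≤ 10 * n * (c * (μ / 480)) := by gcongr
        _ = n * (c * μ) / 48 := by ring
        _ ≤ n * (48 * lam) / 48 := by gcongr
        _ = n * lam := by ring
    linarith

/-- The constant in the rate-distance tradeoff. -/
noncomputable def tradeoffConst (A r : ℝ) (w b : ℕ) : ℝ :=
  147456000 * (w * genConst A r b) ^ 2 + rateConst A r w b * distConst A r w b +
    rateConst A r w b ^ 2

/-- If `k d` is less than a multiple of `n`, the tradeoff follows from `d ^ 3 = O(n ^ 2)` and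
`k ≤ n`. -/
theorem tradeoff (I : StackedImplementation A r w b 𝒞) (h : 𝒞.HasParameters k d)
    (hr : 0 < r) (hA : 0 < A) :
    (k : ℝ) * d ^ 2 * max (k : ℝ) d ^ 2 ≤ tradeoffConst A r w b * n ^ 3 := by
  have hkn : (k : ℝ) ≤ n := by exact_mod_cast k_le_n h
  have hK : 0 ≤ rateConst A r w b := by
    have := genConst_nonneg A r b
    unfold rateConst; positivity
  have hD := distConst_nonneg (r := r) (w := w) (b := b) hA
  set K := rateConst A r w b with hKdef
  set D := distConst A r w b with hDdef
  have h0 : 0 ≤ 147456000 * (w * genConst A r b) ^ 2 * (n : ℝ) ^ 3 := by positivity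
  have h1 : 0 ≤ K * D * (n : ℝ) ^ 3 := by positivity
  have h2 : 0 ≤ K ^ 2 * (n : ℝ) ^ 3 := by positivity
  have e : tradeoffConst A r w b * (n : ℝ) ^ 3 = 147456000 * (w * genConst A r b) ^ 2 * (n : ℝ) ^ 3
      + K * D * (n : ℝ) ^ 3 + K ^ 2 * (n : ℝ) ^ 3 := by
    rw [tradeoffConst]; ring
  rw [e]
  rcases le_total (K * n) (k * d) with hkd | hkd
  · have := I.k_mul_d_le_of_rate h hr hkd
    linarith
  · rcases le_total (d : ℝ) k with hdk | hdk
    · rw [max_eq_left hdk]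
      have : (k : ℝ) * d ^ 2 * k ^ 2 ≤ K ^ 2 * n ^ 3 := by
        calc (k : ℝ) * d ^ 2 * k ^ 2 = (k * d) ^ 2 * k := by ring
          _ ≤ (K * n) ^ 2 * n := by gcongr
          _ = _ := by ring
      linarith
    · rw [max_eq_right hdk]
      have : (k : ℝ) * d ^ 2 * d ^ 2 ≤ K * D * n ^ 3 := by
        calc (k : ℝ) * d ^ 2 * d ^ 2 = (k * d) * d ^ 3 := by ring
          _ ≤ (K * n) * (D * n ^ 2) := by
            have := I.d_pow_three_le h hr hA
            gcongr
          _ = _ := by ring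
      linarith

theorem k_pow_mul_d_pow_le (I : StackedImplementation A r w b 𝒞) (h : 𝒞.HasParameters k d)
    (hr : 0 < r) (hA : 0 < A) : (k : ℝ) ^ 3 * d ^ 2 ≤ tradeoffConst A r w b * n ^ 3 := by
  refine le_trans ?_ (I.tradeoff h hr hA)
  calc (k : ℝ) ^ 3 * d ^ 2 = k * d ^ 2 * k ^ 2 := by ring
    _ ≤ _ := by gcongr; exact le_max_left _ _

end StackedImplementation

open Filter in
theorem exists_nat_forall_pow_log_lt (C : ℝ) {c e : ℝ} (hc : 0 < c) (he : 0 < e) (m : ℕ) :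
    ∃ N : ℕ, ∀ n : ℕ, N ≤ n → C * Real.log n ^ m < c * (n : ℝ) ^ e := by
  have h1 := (isLittleO_log_rpow_rpow_atTop (m : ℝ) he).bound
    (show 0 < c / (2 * (|C| + 1)) by positivity)
  have h2 := (tendsto_natCast_atTop_atTop (R := ℝ)).eventually h1
  obtain ⟨N, hN⟩ := eventually_atTop.1 h2
  refine ⟨max N 1, fun n hn => ?_⟩
  have hn1 : (1 : ℝ) ≤ n := by exact_mod_cast (le_max_right N 1).trans hn
  have h3 := hN n ((le_max_left N 1).trans hn)
  have hlog : 0 ≤ Real.log n := Real.log_nonneg hn1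
  rw [Real.rpow_natCast, Real.norm_of_nonneg (by positivity), Real.norm_of_nonneg (by positivity)]
    at h3
  have hp : 0 < (n : ℝ) ^ e := by positivity
  calc C * Real.log n ^ m ≤ (|C| + 1) * Real.log n ^ m := by
        gcongr
        linarith [le_abs_self C]
    _ ≤ (|C| + 1) * (c / (2 * (|C| + 1)) * (n : ℝ) ^ e) := by gcongr
    _ = c * (n : ℝ) ^ e / 2 := by field_simp
    _ < c * (n : ℝ) ^ e := half_lt_self (by positivity)

theorem corollary1 (A r : ℝ) (hA : 0 < A) (hr : 0 < r) (w b : ℕ) :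
    (∃ C : ℝ, 0 < C ∧
      (∀ (n : ℕ) (𝒞 : StabilizerCode n) (I : StackedImplementation A r w b 𝒞) (ℓ : ℝ), 0 < ℓ →
        ((I.interactions ℓ).ncard : ℝ) ≤ C * ((n : ℝ) / ℓ ^ 2)) ∧
      (∀ (n k d : ℕ) (𝒞 : StabilizerCode n), 𝒞.HasParameters k d →
        Nonempty (StackedImplementation A r w b 𝒞) →
          (d : ℝ) ≤ C * (n : ℝ) ^ (2 / 3 : ℝ) ∧
          (k : ℝ) * (d : ℝ) ^ 2 * (max (k : ℝ) (d : ℝ)) ^ 2 ≤ C * (n : ℝ) ^ 3)) ∧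
    (∀ a : ℝ, 0 < a → ∃ N : ℕ, ∀ (n k d : ℕ) (𝒞 : StabilizerCode n), N ≤ n →
      𝒞.HasParameters k d → a * (n : ℝ) ≤ k → a * √(n : ℝ) ≤ d →
        ¬ Nonempty (StackedImplementation A r w b 𝒞)) ∧
    (∀ (a : ℝ) (s : ℕ), 0 < a → ∃ N : ℕ, ∀ (n k d : ℕ) (𝒞 : StabilizerCode n), N ≤ n →
      𝒞.HasParameters k d →
      a * (n : ℝ) ^ (4 / 5 : ℝ) / Real.log n ^ s ≤ k →
      a * (n : ℝ) ^ (3 / 5 : ℝ) / Real.log n ^ s ≤ d →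
        ¬ Nonempty (StackedImplementation A r w b 𝒞)) := by
  refine ⟨?_, ?_, ?_⟩
  · have hG := StackedImplementation.genConst_nonneg A r b
    have hD := StackedImplementation.distConst_nonneg (r := r) (w := w) (b := b) hA
    set C₁ := w ^ 2 * StackedImplementation.genConst A r b
    set D := StackedImplementation.distConst A r w b
    set T := StackedImplementation.tradeoffConst A r w b
    have hC₁ : 0 ≤ C₁ := by positivity
    refine ⟨1 + C₁ + D + |T|, by positivity, fun n 𝒞 I ℓ hℓ => ?_, ?_⟩
    · refine (I.card_interactions_le hr hℓ).trans ?_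
      gcongr
      have := abs_nonneg T
      linarith
    · rintro n k d 𝒞 h ⟨I⟩
      constructor
      · have h3 : (d : ℝ) ^ 3 ≤ ((1 + D) * (n : ℝ) ^ (2 / 3 : ℝ)) ^ 3 := by
          calc (d : ℝ) ^ 3 ≤ D * n ^ 2 := I.d_pow_three_le h hr hA
            _ ≤ (1 + D) ^ 3 * n ^ 2 := by
              gcongr
              nlinarith [mul_nonneg hD hD, mul_nonneg (mul_nonneg hD hD) hD]
            _ = _ := by
              rw [mul_pow, ← Real.rpow_mul_natCast (by positivity)]
              norm_num
        refine (le_of_pow_le_pow_left₀ (by norm_num) (by positivity) h3).trans ?_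
        exact mul_le_mul_of_nonneg_right (by linarith [abs_nonneg T]) (by positivity)
      · refine (I.tradeoff h hr hA).trans ?_
        gcongr
        have := le_abs_self T
        linarith
  · intro a ha
    obtain ⟨N, hN⟩ := exists_nat_gt (StackedImplementation.tradeoffConst A r w b / a ^ 5)
    refine ⟨N + 1, ?_⟩
    rintro n k d 𝒞 hn h hk hd ⟨I⟩
    have hn1 : (0 : ℝ) < n := by exact_mod_cast (show 0 < n by lia)
    have hNn : (N : ℝ) ≤ n := by exact_mod_cast (show N ≤ n by lia)
    rw [div_lt_iff₀ (by positivity)] at hN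
    have h1 : a ^ 5 * n * n ^ 3 ≤ StackedImplementation.tradeoffConst A r w b * n ^ 3 := by
      calc a ^ 5 * n * (n : ℝ) ^ 3 = (a * n) ^ 3 * (a ^ 2 * n) := by ring
        _ = (a * n) ^ 3 * (a * √n) ^ 2 := by rw [mul_pow a (√n), Real.sq_sqrt hn1.le]
        _ ≤ (k : ℝ) ^ 3 * d ^ 2 := by gcongr
        _ ≤ _ := I.k_pow_mul_d_pow_le h hr hA
    have h2 := le_of_mul_le_mul_right h1 (by positivity)
    have h3 : (N : ℝ) * a ^ 5 ≤ n * a ^ 5 := by gcongr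
    linarith
  · intro a s ha
    obtain ⟨N, hN⟩ := exists_nat_forall_pow_log_lt (StackedImplementation.tradeoffConst A r w b)
      (show 0 < a ^ 5 by positivity) (show (0 : ℝ) < 3 / 5 by norm_num) (5 * s)
    refine ⟨N + 2, ?_⟩
    rintro n k d 𝒞 hn h hk hd ⟨I⟩
    have hn1 : (1 : ℝ) < n := by exact_mod_cast (show 1 < n by lia)
    have hn0 : (0 : ℝ) < n := by linarith
    have hlog : 0 < Real.log n := Real.log_pos hn1
    have h1 := hN n (by lia)
    have e1 : ((n : ℝ) ^ (4 / 5 : ℝ)) ^ 3 * ((n : ℝ) ^ (3 / 5 : ℝ)) ^ 2 =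
        (n : ℝ) ^ (3 / 5 : ℝ) * n ^ 3 := by
      rw [← Real.rpow_mul_natCast hn0.le, ← Real.rpow_mul_natCast hn0.le,
        ← Real.rpow_natCast (n : ℝ) 3, ← Real.rpow_add hn0, ← Real.rpow_add hn0]
      norm_num
    have h2 : a ^ 5 * (n : ℝ) ^ (3 / 5 : ℝ) * n ^ 3 / Real.log n ^ (5 * s) ≤
        StackedImplementation.tradeoffConst A r w b * n ^ 3 := by
      calc a ^ 5 * (n : ℝ) ^ (3 / 5 : ℝ) * n ^ 3 / Real.log n ^ (5 * s) =
          (a * (n : ℝ) ^ (4 / 5 : ℝ) / Real.log n ^ s) ^ 3 *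
            (a * (n : ℝ) ^ (3 / 5 : ℝ) / Real.log n ^ s) ^ 2 := by
            rw [mul_assoc (a ^ 5), ← e1]
            field_simp
            ring
        _ ≤ (k : ℝ) ^ 3 * d ^ 2 := by gcongr
        _ ≤ _ := I.k_pow_mul_d_pow_le h hr hA
    rw [div_le_iff₀ (by positivity)] at h2
    have h3 : a ^ 5 * (n : ℝ) ^ (3 / 5 : ℝ) ≤
        StackedImplementation.tradeoffConst A r w b * Real.log n ^ (5 * s) := by
      refine le_of_mul_le_mul_right (h2.trans_eq ?_) (show 0 < (n : ℝ) ^ 3 by positivity)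
      ring
    linarith
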